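/- All systems are finite-dimensional (of dimension at least $1$), logarithms are in base $2$, a quantum channel is a completely positive trace-preserving linear map, and $\mathcal R^{\pi}_{A\to B}(X)=\operatorname{tr}[X]\,\mathbb 1_B/d_B$ is the replacement channel, with $\mathcal R^\pi_A:=\mathcal R^\pi_{A\to A}$. *Non-signalling superchannels.* A superchannel is a linear supermap $\Theta$ such that $(\mathbb I_R\otimes\Theta)$ maps quantum channels to quantum channels for all reference systems $R_0,R_1$. A superchannel $\Theta$ from maps $\bar A_0\bar B_0\to\bar A_1\bar B_1$ to maps $A_0B_0\to A_1B_1$ is a non-signalling bipartite superchannel if, for every linear map $\mathcal M$ from operators on $\bar A_0\bar B_0$ to operators on $\bar A_1\bar B_1$, $$\mathcal R^\pi_{A_1}\circ\Theta(\mathcal M\circ\mathcal R^\pi_{\bar A_0})\circ\mathcal R^\pi_{A_0}=\mathcal R^\pi_{A_1}\circ\Theta(\mathcal M\circ\mathcal R^\pi_{\bar A_0}),\qquad \mathcal R^\pi_{A_1}\circ\Theta(\mathcal R^\pi_{\bar A_1}\circ\mathcal M)=\mathcal R^\pi_{A_1}\circ\Theta(\mathcal M),$$ and the same two identities hold with $B$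 in place of $A$. *Cost.* For $m\ge 1$ let $\Upsilon_m$ be the noiseless bidirectional classical channel on $m$-dimensional systems, $\Upsilon_m(|k\rangle\langle k'|_{\bar A_0}\otimes|l\rangle\langle l'|_{\bar B_0})=\delta_{kk'}\delta_{ll'}\,|l\rangle\langle l|_{\bar A_1}\otimes|k\rangle\langle k|_{\bar B_1}$. For a bipartite map $\mathcal N_{A_0B_0\to A_1B_1}$ put $$e_{\mathrm{NS}}(\Upsilon_m,\mathcal N)=\tfrac12\inf_\Theta\|\Theta(\Upsilon_m)-\mathcal N\|_\diamond,\qquad S^{(1)}_{\leftrightarrow,0}(\mathcal N)=\log\inf\{m\ge 1 : e_{\mathrm{NS}}(\Upsilon_m,\mathcal N)\le 0\},$$ where $\Theta$ ranges over all non-signalling bipartite superchannels. The asymptotic exact bidirectional classical communication cost is $$S_{\leftrightarrow,0}(\mathcal N)=\liminf_{n\to\infty}\tfrac1n S^{(1)}_{\leftrightarrow,0}(\mathcal N^{\otimes n}),$$ which is the limit whenever the limit exists. *Min-entropies.* For states let $D_{\max}(\rho\|\sigma)=\log\min\{t\ge 0:\rho\le t\sigma\}$ ($+\infty$ if there is no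 such $t$), and for channels let $D_{\max}(\mathcal N\|\mathcal E)=\sup_\psi D_{\max}(\mathcal N(\psi_{RA})\|\mathcal E(\psi_{RA}))$ over pure states $\psi_{RA}$ with $R\cong A$. Define $$H_{\min}(\mathbf A|\mathbf B)_{\mathcal N}=-\inf_{\mathcal X} D_{\max}\big(\mathcal R^\pi_{A_1}\circ\mathcal N\,\big\|\,\mathcal R^\pi_{A_0\to A_1}\otimes\mathcal X\big),\qquad H_{\min}(\mathbf B|\mathbf A)_{\mathcal N}=-\inf_{\mathcal Y} D_{\max}\big(\mathcal R^\pi_{B_1}\circ\mathcal N\,\big\|\,\mathcal Y\otimes\mathcal R^\pi_{B_0\to B_1}\big),$$ with $\mathcal X$ ranging over all channels $B_0\to B_1$ and $\mathcal Y$ over all channels $A_0\to A_1$. **Theorem.** For every bipartite quantum channel $\mathcal N_{A_0B_0\to A_1B_1}$, $$S_{\leftrightarrow,0}(\mathcal N)\ \ge\ -\min\big\{H_{\min}(\mathbf A|\mathbf B)_{\mathcal N},\,H_{\min}(\mathbf B|\mathbf A)_{\mathcal N}\big\}.$$ -/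

import Mathlib

open Filter
open scoped ENNReal NNReal Kronecker ComplexOrder

noncomputable section

namespace BiComm

/-! Finite-dimensional quantum systems are represented by finite index types: the Hilbert space of
the system `A` is `ℂ^A`, and a composite system is a product type. -/

/-- Linear operators on the system `A`. -/
abbrev Op (A : Type*) : Type _ := Matrix A A ℂ

/-- Linear maps from the operators on `A` to the operators on `B`. -/
abbrev OpMap (A B : Type*) : Type _ := Op A →ₗ[ℂ] Op B

/-- Linear supermaps, turning linear maps `A → B` into linear maps `C → D`. -/
abbrev Supermap (A B C D : Type*) : Type _ :=
  OpMap A B →ₗ[ℂ] OpMap C D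

section Maps

variable {A B C D : Type*} [Fintype A] [DecidableEq A] [Fintype B] [DecidableEq B]
  [Fintype C] [DecidableEq C] [Fintype D] [DecidableEq D]

/-- The tensor product `Φ ⊗ Ψ` of two linear maps on operators, expanded in matrix units. -/
def tensorMap (Φ : OpMap A B) (Ψ : OpMap C D) : OpMap (A × C) (B × D) where
  toFun X := ∑ a, ∑ a', ∑ c, ∑ c',
    X (a, c) (a', c') • (Φ (Matrix.single a a' 1) ⊗ₖ Ψ (Matrix.single c c' 1))
  map_add' X Y := by
    simp only [Matrix.add_apply, add_smul, Finset.sum_add_distrib]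
  map_smul' z X := by
    simp only [Matrix.smul_apply, smul_eq_mul, mul_smul, Finset.smul_sum, RingHom.id_apply]

/-- Complete positivity: `id_k ⊗ Φ` preserves positive semidefiniteness for every `k`. -/
def IsCompletelyPositive (Φ : OpMap A B) : Prop :=
  ∀ (k : ℕ) (X : Op (Fin k × A)), X.PosSemidef →
    (tensorMap (LinearMap.id : OpMap (Fin k) (Fin k)) Φ X).PosSemidef

/-- Quantum channels: completely positive trace-preserving linear maps. -/
def IsChannel (Φ : OpMap A B) : Prop :=
  IsCompletelyPositive Φ ∧ ∀ X : Op A, (Φ X).trace = X.trace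

/-- The maximally mixed state `1 / d_A`. -/
def maxMixed (A : Type*) [Fintype A] [DecidableEq A] : Op A :=
  ((Fintype.card A : ℂ)⁻¹) • (1 : Op A)

/-- The replacement channel `X ↦ tr[X] π_B` from `A` to `B`. -/
def replacer (A B : Type*) [Fintype A] [Fintype B] [DecidableEq B] : OpMap A B :=
  (Matrix.traceLinearMap A ℂ ℂ).smulRight (maxMixed B)

/-- The replacement channel on the first factor (Alice) of a composite system. -/
def replaceFst (A B : Type*) [Fintype A] [DecidableEq A] [Fintype B] [DecidableEq B] :
    OpMap (A × B) (A × B) :=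
  tensorMap (replacer A A) LinearMap.id

/-- The replacement channel on the second factor (Bob) of a composite system. -/
def replaceSnd (A B : Type*) [Fintype A] [DecidableEq A] [Fintype B] [DecidableEq B] :
    OpMap (A × B) (A × B) :=
  tensorMap LinearMap.id (replacer B B)

end Maps

section Superchannels

variable {A B C D : Type*} [Fintype A] [DecidableEq A] [Fintype B] [DecidableEq B]
  [Fintype C] [DecidableEq C] [Fintype D] [DecidableEq D]

/-- The component of `N : R₀A → R₁B` at `|r₀⟩⟨r₀'|` on `R₀` and at the entry `(r₁, r₁')` on `R₁`:
the map `X ↦ ⟨r₁| N(|r₀⟩⟨r₀'| ⊗ X) |r₁'⟩`. -/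
def refComponent {R₀ R₁ : Type*} [DecidableEq R₀]
    (N : OpMap (R₀ × A) (R₁ × B)) (r₀ r₀' : R₀) (r₁ r₁' : R₁) : OpMap A B where
  toFun X := (N (Matrix.single r₀ r₀' 1 ⊗ₖ X)).submatrix (Prod.mk r₁) (Prod.mk r₁')
  map_add' X Y := by
    ext b b'
    simp [Matrix.kronecker_add]
  map_smul' z X := by
    ext b b'
    simp [Matrix.kronecker_smul]

/-- The action `(𝕀_R ⊗ Θ)(N)` of a supermap `Θ` on a map `N : R₀A → R₁B` with reference systems:
`Θ` acts on each component of `N` with respect to the reference. -/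
def Supermap.withRef (Θ : Supermap A B C D) {R₀ R₁ : Type*} [Fintype R₀] [DecidableEq R₀]
    (N : OpMap (R₀ × A) (R₁ × B)) : OpMap (R₀ × C) (R₁ × D) where
  toFun Y := Matrix.of fun p q => ∑ r₀, ∑ r₀',
    Θ (refComponent N r₀ r₀' p.1 q.1) (Y.submatrix (Prod.mk r₀) (Prod.mk r₀')) p.2 q.2
  map_add' Y Z := by
    ext p q
    simp [Matrix.submatrix_add, Finset.sum_add_distrib]
  map_smul' z Y := by
    ext p q
    simp [Matrix.submatrix_smul, Finset.mul_sum]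

/-- Superchannels: linear supermaps sending channels to channels, also when acting on a part of
a channel with arbitrary reference systems. -/
def IsSuperchannel (Θ : Supermap A B C D) : Prop :=
  ∀ (r₀ r₁ : ℕ) (N : OpMap (Fin r₀ × A) (Fin r₁ × B)), IsChannel N → IsChannel (Θ.withRef N)

end Superchannels

section Nonsignalling

variable {A₀ B₀ A₁ B₁ : Type*}
  [Fintype A₀] [DecidableEq A₀] [Fintype B₀] [DecidableEq B₀]
  [Fintype A₁] [DecidableEq A₁] [Fintype B₁] [DecidableEq B₁]

/-- Non-signalling bipartite superchannels, from bipartite maps `A₀'B₀' → A₁'B₁'` to bipartite maps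
`A₀B₀ → A₁B₁`. A replacement channel, seen as a supermap, is composed before a map when it acts on
an input system and after it when it acts on an output system. -/
structure IsNSSuperchannel {A₀' B₀' A₁' B₁' : Type*}
    [Fintype A₀'] [DecidableEq A₀'] [Fintype B₀'] [DecidableEq B₀']
    [Fintype A₁'] [DecidableEq A₁'] [Fintype B₁'] [DecidableEq B₁']
    (Θ : Supermap (A₀' × B₀') (A₁' × B₁') (A₀ × B₀) (A₁ × B₁)) : Prop where
  isSuperchannel : IsSuperchannel Θ
  alice_in : ∀ N : OpMap (A₀' × B₀') (A₁' × B₁'),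
    replaceFst A₁ B₁ ∘ₗ Θ (N ∘ₗ replaceFst A₀' B₀') ∘ₗ replaceFst A₀ B₀ =
      replaceFst A₁ B₁ ∘ₗ Θ (N ∘ₗ replaceFst A₀' B₀')
  alice_out : ∀ N : OpMap (A₀' × B₀') (A₁' × B₁'),
    replaceFst A₁ B₁ ∘ₗ Θ (replaceFst A₁' B₁' ∘ₗ N) = replaceFst A₁ B₁ ∘ₗ Θ N
  bob_in : ∀ N : OpMap (A₀' × B₀') (A₁' × B₁'),
    replaceSnd A₁ B₁ ∘ₗ Θ (N ∘ₗ replaceSnd A₀' B₀') ∘ₗ replaceSnd A₀ B₀ =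
      replaceSnd A₁ B₁ ∘ₗ Θ (N ∘ₗ replaceSnd A₀' B₀')
  bob_out : ∀ N : OpMap (A₀' × B₀') (A₁' × B₁'),
    replaceSnd A₁ B₁ ∘ₗ Θ (replaceSnd A₁' B₁' ∘ₗ N) = replaceSnd A₁ B₁ ∘ₗ Θ N

end Nonsignalling

section Norms

variable {A B : Type*} [Fintype A] [DecidableEq A] [Fintype B] [DecidableEq B]

/-- The trace norm `‖X‖₁`, the sum of the singular values of `X`. -/
def traceNorm (X : Op A) : ℝ :=
  ∑ i, √((Matrix.isHermitian_conjTranspose_mul_self X).eigenvalues i)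

/-- The diamond norm `sup_k sup_{‖X‖₁ ≤ 1} ‖(F ⊗ id_k)(X)‖₁`. -/
def diamondNorm (F : OpMap A B) : ℝ≥0∞ :=
  ⨆ (k : ℕ) (X : Op (A × Fin k)) (_ : traceNorm X ≤ 1),
    ENNReal.ofReal (traceNorm (tensorMap F (LinearMap.id : OpMap (Fin k) (Fin k)) X))

end Norms

/-- The logarithm in base `2`, with `log 0 = ⊥` and `log ∞ = ⊤`. -/
def log2 (x : ℝ≥0∞) : EReal := ENNReal.log x / ((Real.log 2 : ℝ) : EReal)

section Cost

variable {A₀ B₀ A₁ B₁ : Type*}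
  [Fintype A₀] [DecidableEq A₀] [Fintype B₀] [DecidableEq B₀]
  [Fintype A₁] [DecidableEq A₁] [Fintype B₁] [DecidableEq B₁]

/-- The minimum error `e_NS(N, M)` of simulating `M` from `N` via non-signalling bipartite
superchannels. -/
def simError {A₀' B₀' A₁' B₁' : Type*}
    [Fintype A₀'] [DecidableEq A₀'] [Fintype B₀'] [DecidableEq B₀']
    [Fintype A₁'] [DecidableEq A₁'] [Fintype B₁'] [DecidableEq B₁']
    (N : OpMap (A₀' × B₀') (A₁' × B₁')) (M : OpMap (A₀ × B₀) (A₁ × B₁)) : ℝ≥0∞ :=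
  2⁻¹ * ⨅ (Θ : Supermap (A₀' × B₀') (A₁' × B₁') (A₀ × B₀) (A₁ × B₁)) (_ : IsNSSuperchannel Θ),
    diamondNorm (Θ N - M)

/-- The bidirectional classical noiseless channel `Υ_m`, mapping `|k⟩⟨k'| ⊗ |l⟩⟨l'|` to
`|l⟩⟨l| ⊗ |k⟩⟨k|` if `k = k'` and `l = l'`, and to `0` otherwise. -/
def classicalSwap (m : ℕ) : OpMap (Fin m × Fin m) (Fin m × Fin m) where
  toFun X := Matrix.diagonal fun p => X (p.2, p.1) (p.2, p.1)
  map_add' X Y := by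
    ext p q
    by_cases h : p = q <;> simp [Matrix.diagonal, h]
  map_smul' z X := by
    ext p q
    by_cases h : p = q <;> simp [Matrix.diagonal, h]

/-- The one-shot `ε`-error bidirectional classical communication cost (in bits). -/
def oneShotCost (ε : ℝ≥0) (N : OpMap (A₀ × B₀) (A₁ × B₁)) : EReal :=
  log2 (⨅ (m : ℕ) (_ : 1 ≤ m) (_ : simError (classicalSwap m) N ≤ ε), (m : ℝ≥0∞))

/-- The `n`-fold tensor power `N^{⊗n}` of a bipartite map, as a bipartite map
`A₀ⁿ B₀ⁿ → A₁ⁿ B₁ⁿ`, expanded in matrix units. -/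
def tensorPow (N : OpMap (A₀ × B₀) (A₁ × B₁)) (n : ℕ) :
    OpMap ((Fin n → A₀) × (Fin n → B₀)) ((Fin n → A₁) × (Fin n → B₁)) where
  toFun X := ∑ p, ∑ q, X p q • Matrix.of fun r s =>
    ∏ i, N (Matrix.single (p.1 i, p.2 i) (q.1 i, q.2 i) 1) (r.1 i, r.2 i) (s.1 i, s.2 i)
  map_add' X Y := by
    simp only [Matrix.add_apply, add_smul, Finset.sum_add_distrib]
  map_smul' z X := by
    simp only [Matrix.smul_apply, smul_eq_mul, mul_smul, Finset.smul_sum, RingHom.id_apply]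

/-- The asymptotic exact bidirectional classical communication cost: the limit of the normalized
one-shot exact costs of `N^{⊗n}`, taken as a lower limit so that it is defined without a separate
proof of convergence. -/
def asymptoticExactCost (N : OpMap (A₀ × B₀) (A₁ × B₁)) : EReal :=
  liminf (fun n : ℕ => oneShotCost 0 (tensorPow N n) / (n : EReal)) atTop

/-- Whenever the normalized one-shot exact costs converge, their limit is the asymptotic cost. -/
theorem asymptoticExactCost_eq_of_tendsto (N : OpMap (A₀ × B₀) (A₁ × B₁)) (S : EReal)
    (h : Tendsto (fun n : ℕ => oneShotCost 0 (tensorPow N n) / (n : EReal)) atTop (nhds S)) :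
    asymptoticExactCost N = S :=
  h.liminf_eq

end Cost

section Entropy

/-- The max-relative entropy `D_max(ρ‖σ) = log min {t | ρ ≤ t σ}` (`⊤` if there is no such `t`). -/
def stateDmax {A : Type*} (ρ σ : Op A) : EReal :=
  log2 (⨅ (t : ℝ≥0) (_ : (((t : ℝ) : ℂ) • σ - ρ).PosSemidef), (t : ℝ≥0∞))

/-- The channel max-relative entropy: the supremum of `D_max(N(ψ_RA)‖E(ψ_RA))` over all pure
states `ψ_RA`, the reference `R` being a copy of the input system `A`. -/
def channelDmax {A B : Type*} [Fintype A] [DecidableEq A] [Fintype B] [DecidableEq B]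
    (N E : OpMap A B) : EReal :=
  ⨆ (ψ : A × A → ℂ) (_ : ∑ p, ‖ψ p‖ ^ 2 = 1),
    stateDmax (tensorMap (LinearMap.id : OpMap A A) N (Matrix.vecMulVec ψ (star ψ)))
      (tensorMap (LinearMap.id : OpMap A A) E (Matrix.vecMulVec ψ (star ψ)))

variable {A₀ B₀ A₁ B₁ : Type*}
  [Fintype A₀] [DecidableEq A₀] [Fintype B₀] [DecidableEq B₀]
  [Fintype A₁] [DecidableEq A₁] [Fintype B₁] [DecidableEq B₁]

/-- The bipartite conditional min-entropy `H_min(A|B)_N`. -/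
def condMinEntropyAB (N : OpMap (A₀ × B₀) (A₁ × B₁)) : EReal :=
  -⨅ (X : OpMap B₀ B₁) (_ : IsChannel X),
    channelDmax (replaceFst A₁ B₁ ∘ₗ N) (tensorMap (replacer A₀ A₁) X)

/-- The bipartite conditional min-entropy `H_min(B|A)_N`. -/
def condMinEntropyBA (N : OpMap (A₀ × B₀) (A₁ × B₁)) : EReal :=
  -⨅ (Y : OpMap A₀ A₁) (_ : IsChannel Y),
    channelDmax (replaceSnd A₁ B₁ ∘ₗ N) (tensorMap Y (replacer B₀ B₁))

end Entropy

end BiComm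

end

set_option linter.unusedSectionVars false

/-! The exponential `2 ^ (-H_min(A|B))` is bounded by a semidefinite program. If J is the Choi
operator of `N` with Alice's output traced out, a number t > 0 is feasible when J ≤ t (1 ⊗ C) for
the Choi operator C of some channel from B₀ to B₁. Feasibility of t bounds the channel max-relative
entropy by log t, so every t with log t below -H_min(A|B) is infeasible.

Infeasibility gives a dual witness (`exists_dual_of_infeasible`): W ≥ 0 with tr_{A₀} W = ρ ⊗ 1, tr ρ
= 1 and tr(J W) ≥ t. Both the constraint and the value are multiplicative, so W^{⊗n} is a witness of
value at least t^n for n copies.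

Conversely, a witness has value at most m on anything simulated from Υ_m
(`re_trace_bobChoi_mul_le`). Non-signalling allows Υ_m to be replaced by its Bob half S, with
Alice's output randomized. This S equals m Q - (m-1) F, where Q is the replacement channel on both
sides and F is a channel. The image of Q ignores Alice's input as far as Bob can see, so the witness
has value exactly 1 on it; on the image of F the value is nonnegative. Hence t^n ≤ m, for every n.

Exact cost only asks that an infimum of errors vanish, so simulations are treated as arbitrarily
good entrywise approximations. The bound with B in place of A follows by exchanging the parties. -/

namespace BiComm

/-! ### Choi matrices and complete positivity -/

section Choi

variable {A B C D R : Type*} [Fintype A] [DecidableEq A] [Fintype B] [DecidableEq B]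
  [Fintype C] [DecidableEq C] [Fintype D] [DecidableEq D] [Fintype R] [DecidableEq R]

theorem posSemidef_of_eq {X Y : Op A} (h : Y.PosSemidef) (e : X = Y) : X.PosSemidef := e ▸ h

theorem tensorMap_apply (Φ : OpMap A B) (Ψ : OpMap C D) (X : Op (A × C)) (p q : B × D) :
    tensorMap Φ Ψ X p q = ∑ a, ∑ a', ∑ c, ∑ c', X (a, c) (a', c') *
      (Φ (Matrix.single a a' 1) p.1 q.1 * Ψ (Matrix.single c c' 1) p.2 q.2) := by
  simp [tensorMap, Matrix.sum_apply, Matrix.kroneckerMap_apply]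

theorem tensorMap_single (Φ : OpMap A B) (Ψ : OpMap C D) (p q : A × C) :
    tensorMap Φ Ψ (Matrix.single p q 1) =
      Φ (Matrix.single p.1 q.1 1) ⊗ₖ Ψ (Matrix.single p.2 q.2 1) := by
  obtain ⟨a, c⟩ := p
  obtain ⟨a', c'⟩ := q
  ext i j
  rw [tensorMap_apply]
  rw [Fintype.sum_eq_single a, Fintype.sum_eq_single a', Fintype.sum_eq_single c,
    Fintype.sum_eq_single c']
  · simp [Matrix.kroneckerMap_apply]
  all_goals
    intro x hx
    simp [hx.symm]

theorem opMap_apply_eq_sum (Φ : OpMap A B) (X : Op A) (b b' : B) :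
    Φ X b b' = ∑ a, ∑ a', X a a' * Φ (Matrix.single a a' 1) b b' := by
  conv_lhs => rw [Matrix.matrix_eq_sum_single X]
  simp only [map_sum, Matrix.sum_apply]
  refine Finset.sum_congr rfl fun a _ => Finset.sum_congr rfl fun a' _ => ?_
  have : Matrix.single a a' (X a a') = X a a' • Matrix.single a a' (1 : ℂ) := by simp
  rw [this, map_smul]
  rfl

theorem opMap_ext {Φ Ψ : OpMap A B}
    (h : ∀ a a' b b', Φ (Matrix.single a a' 1) b b' = Ψ (Matrix.single a a' 1) b b') : Φ = Ψ := by
  refine LinearMap.ext fun X => Matrix.ext fun b b' => ?_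
  rw [opMap_apply_eq_sum Φ, opMap_apply_eq_sum Ψ]
  simp only [h]

/-- The Choi matrix of a linear map on operators. -/
def choi (Φ : OpMap A B) : Op (A × B) :=
  Matrix.of fun p q => Φ (Matrix.single p.1 q.1 1) p.2 q.2

theorem choi_apply (Φ : OpMap A B) (p q : A × B) :
    choi Φ p q = Φ (Matrix.single p.1 q.1 1) p.2 q.2 := rfl

theorem tensorMap_id_apply (Φ : OpMap A B) (X : Op (R × A)) (p q : R × B) :
    tensorMap (LinearMap.id : OpMap R R) Φ X p q =
      ∑ a, ∑ a', X (p.1, a) (q.1, a') * Φ (Matrix.single a a' 1) p.2 q.2 := by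
  rw [tensorMap_apply, Fintype.sum_eq_single p.1, Fintype.sum_eq_single q.1]
  · simp
  all_goals
    intro x hx
    simp [hx]

/-- The output is the compression Vᴴ (X ⊗ choi Φ) V, where V contracts the two copies of `A`. -/
theorem posSemidef_tensorMap_id {Φ : OpMap A B} (h : (choi Φ).PosSemidef) {X : Op (R × A)}
    (hX : X.PosSemidef) : (tensorMap (LinearMap.id : OpMap R R) Φ X).PosSemidef := by
  let V : Matrix ((R × A) × (A × B)) (R × B) ℂ := Matrix.of fun x p =>
    if x.1.1 = p.1 ∧ x.1.2 = x.2.1 ∧ x.2.2 = p.2 then 1 else 0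
  refine posSemidef_of_eq ((hX.kronecker h).conjTranspose_mul_mul_same V) ?_
  ext p q
  rw [tensorMap_id_apply]
  simp only [Matrix.mul_apply, Fintype.sum_prod_type, Matrix.conjTranspose_apply, V,
    Matrix.of_apply, Matrix.kroneckerMap_apply, choi_apply, ite_and]
  simp only [apply_ite star, star_one, star_zero, ite_mul, one_mul, zero_mul, mul_ite, mul_one,
    mul_zero, Finset.sum_ite_eq, Finset.sum_ite_eq', Finset.mem_univ, if_true,
    Finset.sum_ite_irrel, Finset.sum_const_zero]
  exact Finset.sum_comm

theorem isCompletelyPositive_iff_choi {Φ : OpMap A B} :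
    IsCompletelyPositive Φ ↔ (choi Φ).PosSemidef := by
  refine ⟨fun h => ?_, fun h k X hX => posSemidef_tensorMap_id h hX⟩
  let e := Fintype.equivFin A
  -- The unnormalized maximally entangled vector: applying id ⊗ Φ to its projector returns the Choi
  -- matrix.
  let v : Fin (Fintype.card A) × A → ℂ := fun p => if e p.2 = p.1 then 1 else 0
  have h1 := (h _ _ (Matrix.posSemidef_vecMulVec_self_star v)).submatrix
    (fun p : A × B => (e p.1, p.2))
  convert h1 using 1
  ext p q
  rw [Matrix.submatrix_apply, tensorMap_id_apply]
  simp [v, Matrix.vecMulVec_apply, choi_apply]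

theorem isChannel_iff_choi {Φ : OpMap A B} :
    IsChannel Φ ↔ (choi Φ).PosSemidef ∧
      ∀ a a', ∑ b, Φ (Matrix.single a a' 1) b b = if a = a' then 1 else 0 := by
  refine and_congr isCompletelyPositive_iff_choi ⟨fun h a a' => ?_, fun h X => ?_⟩
  · have := h (Matrix.single a a' 1)
    rw [Matrix.trace] at this
    simp only [Matrix.diag_apply] at this
    rw [this]
    split_ifs with haa
    · subst haa
      exact Matrix.trace_single_eq_same a 1
    · exact Matrix.trace_single_eq_of_ne a a' 1 haa
  · simp only [Matrix.trace, Matrix.diag_apply]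
    simp_rw [opMap_apply_eq_sum Φ X]
    rw [Finset.sum_comm]
    refine Finset.sum_congr rfl fun a _ => ?_
    rw [Finset.sum_comm]
    simp_rw [← Finset.mul_sum, h]
    simp

end Choi

/-! ### Bob's marginal of a bipartite map -/

section Marginal

variable {A₀ B₀ A₁ B₁ : Type*}
  [Fintype A₀] [DecidableEq A₀] [Fintype B₀] [DecidableEq B₀]
  [Fintype A₁] [DecidableEq A₁] [Fintype B₁] [DecidableEq B₁]

/-- The Choi matrix of `tr_{A₁} ∘ M` for a bipartite map `M`. -/
def bobChoi : OpMap (A₀ × B₀) (A₁ × B₁) →ₗ[ℂ] Op (A₀ × (B₀ × B₁)) where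
  toFun M := Matrix.of fun p q => ∑ c, M (Matrix.single (p.1, p.2.1) (q.1, q.2.1) 1)
    (c, p.2.2) (c, q.2.2)
  map_add' M M' := by
    ext p q
    simp [Finset.sum_add_distrib]
  map_smul' z M := by
    ext p q
    simp [Finset.mul_sum]

theorem bobChoi_apply (M : OpMap (A₀ × B₀) (A₁ × B₁)) (p q : A₀ × (B₀ × B₁)) :
    bobChoi M p q = ∑ c, M (Matrix.single (p.1, p.2.1) (q.1, q.2.1) 1)
      (c, p.2.2) (c, q.2.2) := rfl

theorem posSemidef_bobChoi {M : OpMap (A₀ × B₀) (A₁ × B₁)} (h : (choi M).PosSemidef) :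
    (bobChoi M).PosSemidef := by
  have : bobChoi M = ∑ c : A₁, (choi M).submatrix
      (fun p : A₀ × (B₀ × B₁) => ((p.1, p.2.1), (c, p.2.2)))
      (fun p : A₀ × (B₀ × B₁) => ((p.1, p.2.1), (c, p.2.2))) := by
    ext p q
    simp [bobChoi_apply, Matrix.sum_apply, choi_apply]
  rw [this]
  exact Matrix.posSemidef_sum _ fun c _ => h.submatrix _

theorem replacer_apply (A B : Type*) [Fintype A] [Fintype B] [DecidableEq B] (X : Op A) :
    replacer A B X = X.trace • maxMixed B := rfl

theorem maxMixed_apply {A : Type*} [Fintype A] [DecidableEq A] (a a' : A) :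
    maxMixed A a a' = if a = a' then (Fintype.card A : ℂ)⁻¹ else 0 := by
  simp [maxMixed, Matrix.one_apply]

theorem sum_maxMixed {A : Type*} [Fintype A] [DecidableEq A] [Nonempty A] :
    ∑ a, maxMixed A a a = 1 := by
  simp [maxMixed_apply]

theorem replacer_single (A B : Type*) [Fintype A] [DecidableEq A] [Fintype B] [DecidableEq B]
    (a a' : A) (b b' : B) :
    replacer A B (Matrix.single a a' 1) b b' = if a = a' then maxMixed B b b' else 0 := by
  rw [replacer_apply]
  split_ifs with h
  · subst h
    rw [Matrix.trace_single_eq_same, one_smul]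
  · rw [Matrix.trace_single_eq_of_ne _ _ _ h, zero_smul, Matrix.zero_apply]

theorem replaceFst_apply (X : Op (A₁ × B₁)) (p q : A₁ × B₁) :
    replaceFst A₁ B₁ X p q = maxMixed A₁ p.1 q.1 * ∑ c, X (c, p.2) (c, q.2) := by
  rw [replaceFst, tensorMap_apply, Finset.mul_sum]
  refine Finset.sum_congr rfl fun a _ => ?_
  rw [Fintype.sum_eq_single a, Fintype.sum_eq_single p.2, Fintype.sum_eq_single q.2]
  · simp [replacer_single, mul_comm]
  all_goals
    intro x hx
    simp [replacer_single, Matrix.single_apply, hx, hx.symm]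

/-- Randomizing Alice's output does not change its partial trace. This strips the outer replacement
channels from the non-signalling identities. -/
theorem bobChoi_replaceFst_comp [Nonempty A₁] (M : OpMap (A₀ × B₀) (A₁ × B₁)) :
    bobChoi (replaceFst A₁ B₁ ∘ₗ M) = bobChoi M := by
  ext p q
  simp only [bobChoi_apply, LinearMap.comp_apply, replaceFst_apply]
  rw [← Finset.sum_mul, sum_maxMixed, one_mul]

theorem replaceFst_single (p q : A₀ × B₀) :
    replaceFst A₀ B₀ (Matrix.single p q 1) =
      maxMixed A₀ ⊗ₖ ((if p.1 = q.1 then (1 : ℂ) else 0) • Matrix.single p.2 q.2 1) := by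
  rw [replaceFst, tensorMap_single]
  ext i j
  simp only [Matrix.kroneckerMap_apply, replacer_single, LinearMap.id_apply, Matrix.smul_apply,
    smul_eq_mul]
  split_ifs <;> simp

/-- Up to reordering factors, this Choi matrix is the maximally mixed state on `A₁` tensored with
the operator in the hypothesis. -/
theorem choi_replace_sub_posSemidef {t : ℝ} {X : OpMap B₀ B₁} {N : OpMap (A₀ × B₀) (A₁ × B₁)}
    (h : ((t : ℂ) • ((1 : Op A₀) ⊗ₖ choi X) - bobChoi N).PosSemidef) :
    (choi ((t : ℂ) • tensorMap (replacer A₀ A₁) X - replaceFst A₁ B₁ ∘ₗ N)).PosSemidef := by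
  have hπ : (maxMixed A₁).PosSemidef :=
    Matrix.PosSemidef.one.smul (by positivity)
  refine posSemidef_of_eq ((hπ.kronecker h).submatrix
    (fun p : (A₀ × B₀) × (A₁ × B₁) => (p.2.1, (p.1.1, (p.1.2, p.2.2))))) ?_
  ext p q
  simp only [choi_apply, LinearMap.sub_apply, LinearMap.smul_apply, Matrix.sub_apply,
    Matrix.smul_apply, LinearMap.comp_apply, replaceFst_apply, tensorMap_single,
    Matrix.kroneckerMap_apply, replacer_single, Matrix.submatrix_apply, bobChoi_apply,
    Matrix.one_apply, smul_eq_mul, Prod.mk.eta]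
  split_ifs <;> ring

end Marginal

/-! ### Positive semidefinite matrices: closedness, compactness, self-duality -/

section Matrices

variable {K : Type*} [Fintype K] [DecidableEq K]

open scoped MatrixOrder in
theorem exists_eq_conjTranspose_mul_self {X : Op K} (hX : X.PosSemidef) :
    ∃ V : Op K, X = V.conjTranspose * V := by
  obtain ⟨V, hV⟩ := CStarAlgebra.nonneg_iff_eq_star_mul_self.mp
    (Matrix.nonneg_iff_posSemidef.mpr hX)
  exact ⟨V, hV⟩

theorem trace_mul_nonneg {X Y : Op K} (hX : X.PosSemidef) (hY : Y.PosSemidef) :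
    0 ≤ (X * Y).trace := by
  obtain ⟨V, rfl⟩ := exists_eq_conjTranspose_mul_self hX
  rw [Matrix.mul_assoc, Matrix.trace_mul_comm]
  exact (hY.mul_mul_conjTranspose_same V).trace_nonneg

theorem norm_apply_le_trace {X : Op K} (hX : X.PosSemidef) (i j : K) : ‖X i j‖ ≤ X.trace.re := by
  have hdiag : ∀ i, (X i i).re ≤ X.trace.re := fun i => by
    rw [Matrix.trace, Complex.re_sum]
    exact Finset.single_le_sum (f := fun i => (X.diag i).re)
      (fun k _ => (Complex.le_def.mp (hX.diag_nonneg (i := k))).1) (Finset.mem_univ i)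
  have h : ‖X i j‖ ≤ ((X i i).re + (X j j).re) / 2 := by
    obtain ⟨V, rfl⟩ := exists_eq_conjTranspose_mul_self hX
    have hd : ∀ i, ((V.conjTranspose * V) i i).re = ∑ k, ‖V k i‖ ^ 2 := fun i => by
      simp [Matrix.mul_apply, Complex.sq_norm, Complex.normSq_apply]
    rw [hd, hd, ← Finset.sum_add_distrib, Finset.sum_div, Matrix.mul_apply]
    refine (norm_sum_le _ _).trans (Finset.sum_le_sum fun k _ => ?_)
    rw [norm_mul, Matrix.conjTranspose_apply, norm_star]
    nlinarith [sq_nonneg (‖V k i‖ - ‖V k j‖)]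
  linarith [hdiag i, hdiag j]

theorem isClosed_posSemidef : IsClosed {X : Op K | X.PosSemidef} := by
  simp only [Matrix.posSemidef_iff_dotProduct_mulVec, Set.ofPred_and, Set.ofPred_forall]
  refine (isClosed_eq (by fun_prop) continuous_id).inter (isClosed_iInter fun x => ?_)
  refine isClosed_le continuous_const ?_
  simp only [dotProduct, Matrix.mulVec]
  fun_prop

theorem isCompact_posSemidef_trace_le (r : ℝ) :
    IsCompact {X : Op K | X.PosSemidef ∧ X.trace.re ≤ r} := by
  have hc : IsCompact (Set.pi Set.univ fun _ : K => Set.pi Set.univ fun _ : K =>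
      Metric.closedBall (0 : ℂ) r) :=
    isCompact_univ_pi fun _ => isCompact_univ_pi fun _ => isCompact_closedBall _ _
  refine IsCompact.of_isClosed_subset hc ?_ ?_
  · rw [Set.ofPred_and]
    refine isClosed_posSemidef.inter (isClosed_le ?_ continuous_const)
    exact Complex.continuous_re.comp (continuous_id.matrix_trace)
  · rintro X ⟨hX, hr⟩ i - j -
    rw [mem_closedBall_zero_iff]
    exact (norm_apply_le_trace hX i j).trans hr

theorem exists_isHermitian_re_trace (g : Op K →ₗ[ℝ] ℝ) :
    ∃ W : Op K, W.IsHermitian ∧ ∀ X : Op K, X.IsHermitian → g X = (W * X).trace.re := by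
  -- A real-linear functional is determined by its values on E_ij and i E_ij; the sign makes Re(G_ji
  -- z) = Re z · g(E_ij) + Im z · g(i E_ij). On Hermitian arguments only the Hermitian part of G
  -- matters.
  let G : Op K := Matrix.of fun j i =>
    (⟨g (Matrix.single i j 1), -g (Matrix.single i j Complex.I)⟩ : ℂ)
  have hG : ∀ X : Op K, g X = (G * X).trace.re := fun X => by
    have hs : ∀ i j (z : ℂ), g (Matrix.single i j z) =
        z.re * g (Matrix.single i j 1) + z.im * g (Matrix.single i j Complex.I) := by
      intro i j z
      have : Matrix.single i j z =
          z.re • Matrix.single i j (1 : ℂ) + z.im • Matrix.single i j Complex.I := by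
        rw [Matrix.smul_single, Matrix.smul_single, ← Matrix.single_add]
        congr 1
        apply Complex.ext <;> simp
      rw [this, map_add, map_smul, map_smul, smul_eq_mul, smul_eq_mul]
    conv_lhs => rw [Matrix.matrix_eq_sum_single X]
    simp only [map_sum, Matrix.trace, Matrix.diag_apply, Matrix.mul_apply, Complex.re_sum]
    rw [Finset.sum_comm]
    refine Finset.sum_congr rfl fun j _ => Finset.sum_congr rfl fun i _ => ?_
    rw [hs]
    simp [G]
    ring
  refine ⟨(2⁻¹ : ℝ) • (G + G.conjTranspose), ?_, fun X hX => ?_⟩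
  · rw [Matrix.IsHermitian, Matrix.conjTranspose_smul, Matrix.conjTranspose_add,
      Matrix.conjTranspose_conjTranspose, add_comm, star_trivial]
  · have h : (G.conjTranspose * X).trace.re = (G * X).trace.re := by
      conv_lhs => rw [← hX.eq, ← Matrix.conjTranspose_mul, Matrix.trace_conjTranspose,
        Matrix.trace_mul_comm]
      simp
    rw [hG, Matrix.smul_mul, Matrix.trace_smul, Complex.smul_re, Matrix.add_mul, Matrix.trace_add,
      Complex.add_re, h, smul_eq_mul]
    ring

theorem posSemidef_of_re_trace_mul_nonneg {W : Op K} (hW : W.IsHermitian)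
    (h : ∀ P : Op K, P.PosSemidef → 0 ≤ (W * P).trace.re) : W.PosSemidef := by
  refine Matrix.posSemidef_iff_dotProduct_mulVec.mpr ⟨hW, fun x => ?_⟩
  have h1 := h _ (Matrix.posSemidef_vecMulVec_self_star x)
  rw [Matrix.mul_vecMulVec, Matrix.trace_vecMulVec, dotProduct_comm] at h1
  refine Complex.le_def.mpr ⟨h1, ?_⟩
  exact (hW.im_star_dotProduct_mulVec_self x).symm

end Matrices

/-! ### Partial traces and their adjoints -/

section PartialTrace

variable {A B D : Type*} [Fintype A] [DecidableEq A] [Fintype B] [DecidableEq B]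
  [Fintype D] [DecidableEq D]

/-- The partial trace over the first factor. -/
def traceFst : Op (A × B) →ₗ[ℂ] Op B where
  toFun X := ∑ a, X.submatrix (Prod.mk a) (Prod.mk a)
  map_add' X Y := by simp [Matrix.submatrix_add, Finset.sum_add_distrib]
  map_smul' z X := by simp [Matrix.submatrix_smul, Finset.smul_sum]

/-- The partial trace over the second factor. -/
def traceSnd : Op (A × B) →ₗ[ℂ] Op A where
  toFun X := ∑ b, X.submatrix (fun a => (a, b)) (fun a => (a, b))
  map_add' X Y := by simp [Matrix.submatrix_add, Finset.sum_add_distrib]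
  map_smul' z X := by simp [Matrix.submatrix_smul, Finset.smul_sum]

theorem traceFst_apply (X : Op (A × B)) (b b' : B) :
    traceFst X b b' = ∑ a, X (a, b) (a, b') := by
  change (∑ a, X.submatrix (Prod.mk a) (Prod.mk a)) b b' = _
  simp [Matrix.sum_apply]

theorem traceSnd_apply (X : Op (A × B)) (a a' : A) :
    traceSnd X a a' = ∑ b, X (a, b) (a', b) := by
  change (∑ b, X.submatrix (fun a => (a, b)) (fun a => (a, b))) a a' = _
  simp [Matrix.sum_apply]

theorem posSemidef_traceFst {X : Op (A × B)} (h : X.PosSemidef) : (traceFst X).PosSemidef :=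
  Matrix.posSemidef_sum _ fun _ _ => h.submatrix _

theorem posSemidef_traceSnd {X : Op (A × B)} (h : X.PosSemidef) : (traceSnd X).PosSemidef :=
  Matrix.posSemidef_sum _ fun _ _ => h.submatrix _

theorem trace_traceFst (X : Op (A × B)) : (traceFst X).trace = X.trace := by
  simp only [Matrix.trace, Matrix.diag_apply, traceFst_apply, Fintype.sum_prod_type]
  exact Finset.sum_comm

theorem trace_traceSnd (X : Op (A × B)) : (traceSnd X).trace = X.trace := by
  simp only [Matrix.trace, Matrix.diag_apply, traceSnd_apply, Fintype.sum_prod_type]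

theorem traceFst_kronecker (X : Op A) (Y : Op B) : traceFst (X ⊗ₖ Y) = X.trace • Y := by
  ext b b'
  simp [traceFst_apply, Matrix.trace, Finset.sum_mul]

theorem trace_one_kronecker_mul (C : Op B) (W : Op (A × B)) :
    (((1 : Op A) ⊗ₖ C) * W).trace = (C * traceFst W).trace := by
  simp only [Matrix.trace, Matrix.diag_apply, Matrix.mul_apply, traceFst_apply,
    Fintype.sum_prod_type, Matrix.kroneckerMap_apply, Matrix.one_apply, ite_mul, one_mul, zero_mul,
    Finset.mul_sum, Finset.sum_ite_irrel, Finset.sum_const_zero, Finset.sum_ite_eq,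
    Finset.mem_univ, if_true]
  rw [Finset.sum_comm]
  exact Finset.sum_congr rfl fun b _ => Finset.sum_comm

theorem trace_kronecker_one_mul (ρ : Op A) (C : Op (A × B)) :
    ((ρ ⊗ₖ (1 : Op B)) * C).trace = (ρ * traceSnd C).trace := by
  simp only [Matrix.trace, Matrix.diag_apply, Matrix.mul_apply, traceSnd_apply,
    Fintype.sum_prod_type, Matrix.kroneckerMap_apply, Matrix.one_apply, mul_ite, mul_one, mul_zero,
    Finset.mul_sum, ite_mul, zero_mul, Finset.sum_ite_eq,
    Finset.mem_univ, if_true]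
  exact Finset.sum_congr rfl fun b _ => Finset.sum_comm

end PartialTrace

/-! ### Strong duality by separation from a closed cone -/

section StrongDuality

variable {A B D : Type*} [Fintype A] [DecidableEq A] [Fintype B] [DecidableEq B]
  [Fintype D] [DecidableEq D]

theorem continuous_one_kronecker : Continuous fun C : Op B => (1 : Op A) ⊗ₖ C :=
  continuous_matrix fun i j => by
    simp only [Matrix.kroneckerMap_apply]
    fun_prop

theorem continuous_traceSnd : Continuous (traceSnd : Op (A × B) → Op A) :=
  continuous_matrix fun i j => by
    simp only [traceSnd_apply]
    fun_prop

theorem one_kronecker_add (X Y : Op B) : (1 : Op A) ⊗ₖ (X + Y) = 1 ⊗ₖ X + 1 ⊗ₖ Y :=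
  Matrix.kronecker_add _ _ _

/-- The cone of all `(t (1 ⊗ C) - P, tr_D C)` with `C`, `P` positive semidefinite. -/
def conditionalCone (t : ℝ) : Set (Op (A × (B × D)) × Op B) :=
  {x | ∃ (C : Op (B × D)) (P : Op (A × (B × D))), C.PosSemidef ∧ P.PosSemidef ∧
    x = (t • ((1 : Op A) ⊗ₖ C) - P, traceSnd C)}

theorem isClosed_conditionalCone (t : ℝ) :
    IsClosed (conditionalCone t : Set (Op (A × (B × D)) × Op B)) := by
  have : FirstCountableTopology (Op (A × (B × D))) :=
    inferInstanceAs (FirstCountableTopology (A × (B × D) → A × (B × D) → ℂ))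
  have : FirstCountableTopology (Op (B × D)) :=
    inferInstanceAs (FirstCountableTopology (B × D → B × D → ℂ))
  have : FirstCountableTopology (Op B) := inferInstanceAs (FirstCountableTopology (B → B → ℂ))
  refine IsSeqClosed.isClosed fun x y hx hlim => ?_
  choose C P hC hP hxe using hx
  have h1 : Tendsto (fun n => (x n).1) atTop (nhds y.1) :=
    (continuous_fst.tendsto y).comp hlim
  have h2 : Tendsto (fun n => (x n).2) atTop (nhds y.2) :=
    (continuous_snd.tendsto y).comp hlim
  -- The trace of the second component is the trace of C, so convergence keeps the C's in a compact
  -- set. A subsequence converges, and P is recovered as a difference of limits.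
  have h3 : Tendsto (fun n => (x n).2.trace.re) atTop (nhds y.2.trace.re) :=
    ((Complex.continuous_re.comp (continuous_id.matrix_trace)).tendsto y.2).comp h2
  obtain ⟨r, hr⟩ := h3.bddAbove_range
  have hCr : ∀ n, C n ∈ {X : Op (B × D) | X.PosSemidef ∧ X.trace.re ≤ r} := fun n => by
    refine ⟨hC n, ?_⟩
    have : (x n).2.trace.re ≤ r := hr ⟨n, rfl⟩
    rwa [hxe n, trace_traceSnd] at this
  obtain ⟨C', hC', φ, hφ, hlimC⟩ := (isCompact_posSemidef_trace_le r).tendsto_subseq hCr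
  refine ⟨C', t • ((1 : Op A) ⊗ₖ C') - y.1, hC'.1, ?_, ?_⟩
  · have hlimP : Tendsto (fun n => t • ((1 : Op A) ⊗ₖ C (φ n)) - (x (φ n)).1) atTop
        (nhds (t • ((1 : Op A) ⊗ₖ C') - y.1)) :=
      (((continuous_one_kronecker.tendsto C').comp hlimC).const_smul t).sub
        (h1.comp hφ.tendsto_atTop)
    refine isClosed_posSemidef.mem_of_tendsto hlimP (Eventually.of_forall fun n => ?_)
    have : t • ((1 : Op A) ⊗ₖ C (φ n)) - (x (φ n)).1 = P (φ n) := by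
      rw [hxe (φ n)]
      simp
    rw [this]
    exact hP _
  · refine Prod.ext (by simp) ?_
    refine tendsto_nhds_unique (h2.comp hφ.tendsto_atTop) ?_
    refine ((continuous_traceSnd.tendsto C').comp hlimC).congr fun n => ?_
    simp [hxe (φ n)]

/-- The cone `conditionalCone` as a proper cone. -/
def conditionalProperCone (t : ℝ) : ProperCone ℝ (Op (A × (B × D)) × Op B) where
  carrier := conditionalCone t
  isClosed' := isClosed_conditionalCone t
  zero_mem' := ⟨0, 0, .zero, .zero, Prod.ext (by simp) (by simp)⟩
  add_mem' := by
    rintro _ _ ⟨C, P, hC, hP, rfl⟩ ⟨C', P', hC', hP', rfl⟩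
    refine ⟨C + C', P + P', hC.add hC', hP.add hP', ?_⟩
    simp only [Prod.mk_add_mk, map_add, one_kronecker_add, smul_add]
    congr 1
    abel
  smul_mem' := by
    rintro c _ ⟨C, P, hC, hP, rfl⟩
    refine ⟨(c : ℝ) • C, (c : ℝ) • P, hC.smul c.2, hP.smul c.2, ?_⟩
    change ((c : ℝ) • _, (c : ℝ) • _) = _
    rw [Matrix.kronecker_smul, smul_sub, smul_comm, LinearMap.map_smul_of_tower]

/-- Strong duality for the semidefinite program
`min {t | J ≤ t (1 ⊗ C), C ≥ 0, tr_D C = 1}`, with a dual solution that satisfies its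
constraint with equality. -/
theorem exists_dual_of_infeasible [Nonempty A] [Nonempty D] {t : ℝ} (ht : 0 < t)
    {J : Op (A × (B × D))} (hJ : J.PosSemidef)
    (h : ∀ C : Op (B × D), C.PosSemidef → traceSnd C = 1 →
      ¬ (t • ((1 : Op A) ⊗ₖ C) - J).PosSemidef) :
    ∃ (W : Op (A × (B × D))) (ρ : Op B), W.PosSemidef ∧ ρ.trace = 1 ∧
      traceFst W = ρ ⊗ₖ (1 : Op D) ∧ t ≤ (J * W).trace.re := by
  have : LocallyConvexSpace ℝ (Op (A × (B × D))) :=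
    inferInstanceAs (LocallyConvexSpace ℝ (A × (B × D) → A × (B × D) → ℂ))
  have : LocallyConvexSpace ℝ (Op B) :=
    inferInstanceAs (LocallyConvexSpace ℝ (B → B → ℂ))
  -- Membership of (J, 1) in the cone is exactly primal feasibility at t.
  have hmem : ((J, 1) : Op (A × (B × D)) × Op B) ∉ conditionalProperCone t := by
    rintro ⟨C, P, hC, hP, he⟩
    obtain ⟨h1, h2⟩ := Prod.mk.inj he
    refine h C hC h2.symm ?_
    rwa [h1, sub_sub_cancel]
  obtain ⟨f, hf, hf0⟩ := ProperCone.hyperplane_separation_point _ hmem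
  obtain ⟨W₀, hW₀, hfW⟩ := exists_isHermitian_re_trace
    (f.toLinearMap ∘ₗ LinearMap.inl ℝ (Op (A × (B × D))) (Op B))
  obtain ⟨ρ, hρ, hfρ⟩ := exists_isHermitian_re_trace
    (f.toLinearMap ∘ₗ LinearMap.inr ℝ (Op (A × (B × D))) (Op B))
  have hfadd : ∀ X Y, X.IsHermitian → Y.IsHermitian →
      f (X, Y) = (W₀ * X).trace.re + (ρ * Y).trace.re := fun X Y hX hY => by
    rw [← hfW X hX, ← hfρ Y hY]
    simp [← map_add]
  set W := -W₀ with hWdef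
  -- Nonnegativity of f on the points (-P, 0) of the cone.
  have hW : W.PosSemidef := by
    refine posSemidef_of_re_trace_mul_nonneg hW₀.neg fun P hP => ?_
    have := hf (-P, 0) ⟨0, P, .zero, hP, by simp⟩
    rw [hfadd _ _ hP.1.neg Matrix.isHermitian_zero] at this
    simpa [hWdef] using this
  -- Nonnegativity of f on the points (t (1 ⊗ C), tr_D C), read through the adjoints of C ↦ 1 ⊗ C
  -- and the partial trace.
  have hZ : (ρ ⊗ₖ (1 : Op D) - t • traceFst W).PosSemidef := by
    refine posSemidef_of_re_trace_mul_nonneg ?_ fun C hC => ?_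
    · refine Matrix.IsHermitian.sub ?_ ((posSemidef_traceFst hW).smul ht.le).1
      rw [Matrix.IsHermitian, Matrix.conjTranspose_kronecker, hρ.eq, Matrix.conjTranspose_one]
    · have h1C : ((1 : Op A) ⊗ₖ C).PosSemidef := Matrix.PosSemidef.one.kronecker hC
      have := hf (t • ((1 : Op A) ⊗ₖ C), traceSnd C) ⟨C, 0, hC, .zero, by simp⟩
      rw [hfadd _ _ (h1C.smul ht.le).1 (posSemidef_traceSnd hC).1] at this
      rw [Matrix.mul_smul, Matrix.trace_smul, Matrix.trace_mul_comm W₀, trace_one_kronecker_mul]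
        at this
      rw [Matrix.sub_mul, Matrix.trace_sub, trace_kronecker_one_mul, Matrix.smul_mul,
        Matrix.trace_smul, Matrix.trace_mul_comm (traceFst W), hWdef, map_neg, Matrix.mul_neg,
        Matrix.trace_neg, smul_neg, sub_neg_eq_add, add_comm]
      exact this
  have hlt : ρ.trace.re < (W * J).trace.re := by
    rw [hfadd _ _ hJ.1 Matrix.isHermitian_one, Matrix.mul_one] at hf0
    rw [hWdef, Matrix.neg_mul, Matrix.trace_neg, Complex.neg_re]
    linarith
  have hπ : (maxMixed A).PosSemidef := Matrix.PosSemidef.one.smul (by positivity)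
  have hπ1 : (maxMixed A).trace = 1 := sum_maxMixed
  -- Placing the slack of the constraint on a maximally mixed `A` turns the inequality into an
  -- equality. The value against J ≥ 0 can only grow.
  set V := t • W + maxMixed A ⊗ₖ (ρ ⊗ₖ (1 : Op D) - t • traceFst W) with hV
  have hVpos : V.PosSemidef := (hW.smul ht.le).add (hπ.kronecker hZ)
  have hVtr : traceFst V = ρ ⊗ₖ (1 : Op D) := by
    rw [hV, map_add, traceFst_kronecker, hπ1, one_smul, LinearMap.map_smul_of_tower]
    abel
  have hVJ : t * ρ.trace.re < (J * V).trace.re := by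
    have h1 := (Complex.le_def.mp (trace_mul_nonneg (hπ.kronecker hZ) hJ)).1
    rw [Matrix.trace_mul_comm J, hV, Matrix.add_mul, Matrix.trace_add, Matrix.smul_mul,
      Matrix.trace_smul, Complex.add_re, Complex.smul_re, smul_eq_mul]
    rw [Complex.zero_re] at h1
    nlinarith
  have hVρ : V.trace = ρ.trace * Fintype.card D := by
    rw [← trace_traceFst, hVtr, Matrix.trace_kronecker, Matrix.trace_one]
  have hcard : (0 : ℝ) < Fintype.card D := by exact_mod_cast Fintype.card_pos
  obtain ⟨s, hs⟩ : ∃ s : ℝ, ρ.trace = s := by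
    refine ⟨ρ.trace.re, Complex.ext rfl ?_⟩
    have := (Complex.le_def.mp hVpos.trace_nonneg).2
    rw [hVρ] at this
    simpa [hcard.ne', Fintype.card_ne_zero] using this.symm
  have hs0 : 0 ≤ s := by
    have := (Complex.le_def.mp hVpos.trace_nonneg).1
    rw [hVρ, hs, ← Complex.ofReal_natCast, ← Complex.ofReal_mul, Complex.ofReal_re,
      Complex.zero_re] at this
    exact nonneg_of_mul_nonneg_left this hcard
  rw [hs, Complex.ofReal_re] at hVJ
  -- If tr ρ = 0 then V = 0, contradicting the strict inequality `hVJ`. So dividing by s is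
  -- legitimate.
  have hs1 : 0 < s := by
    refine lt_of_le_of_ne hs0 fun h0 => ?_
    have : V = 0 := hVpos.trace_eq_zero_iff.mp (by rw [hVρ, hs, ← h0]; simp)
    rw [this, ← h0] at hVJ
    simp at hVJ
  refine ⟨s⁻¹ • V, s⁻¹ • ρ, hVpos.smul (inv_nonneg.mpr hs0), ?_, ?_, ?_⟩
  · rw [Matrix.trace_smul, hs, Complex.real_smul, ← Complex.ofReal_mul, inv_mul_cancel₀ hs1.ne',
      Complex.ofReal_one]
  · rw [LinearMap.map_smul_of_tower, hVtr, Matrix.smul_kronecker]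
  · rw [Matrix.mul_smul, Matrix.trace_smul, Complex.smul_re, smul_eq_mul, ← div_eq_inv_mul,
      le_div_iff₀ hs1]
    exact hVJ.le

end StrongDuality

/-! ### Tensor powers of operators and of dual witnesses -/

section TensorPower

variable {A B D K : Type*} [Fintype A] [DecidableEq A] [Fintype B] [DecidableEq B]
  [Fintype D] [DecidableEq D] [Fintype K] [DecidableEq K]

/-- The `n`-fold tensor power of an operator. -/
def opPow (n : ℕ) (X : Op K) : Op (Fin n → K) :=
  Matrix.of fun p q => ∏ i, X (p i) (q i)

theorem opPow_mul (n : ℕ) (X Y : Op K) : opPow n X * opPow n Y = opPow n (X * Y) := by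
  ext p q
  simp only [opPow, Matrix.mul_apply, Matrix.of_apply, ← Finset.prod_mul_distrib,
    Finset.prod_univ_sum, Fintype.piFinset_univ]

theorem trace_opPow (n : ℕ) (X : Op K) : (opPow n X).trace = X.trace ^ n := by
  simp only [opPow, Matrix.trace, Matrix.diag_apply, Matrix.of_apply]
  rw [Finset.sum_pow', Fintype.piFinset_univ]

theorem posSemidef_opPow (n : ℕ) {X : Op K} (h : X.PosSemidef) : (opPow n X).PosSemidef := by
  obtain ⟨V, rfl⟩ := exists_eq_conjTranspose_mul_self h
  have : opPow n V.conjTranspose = (opPow n V).conjTranspose := by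
    ext p q
    simp [opPow]
  rw [← opPow_mul, this]
  exact Matrix.posSemidef_conjTranspose_mul_self _

/-- Triples of sequences as sequences of triples. -/
def arrowTripleEquiv (A B D : Type*) (n : ℕ) :
    (Fin n → A) × ((Fin n → B) × (Fin n → D)) ≃ (Fin n → A × (B × D)) where
  toFun p i := (p.1 i, (p.2.1 i, p.2.2 i))
  invFun f := (fun i => (f i).1, (fun i => (f i).2.1, fun i => (f i).2.2))

/-- The `n`-fold tensor power of a tripartite operator, as a tripartite operator. -/
def tripartitePow (n : ℕ) (X : Op (A × (B × D))) :
    Op ((Fin n → A) × ((Fin n → B) × (Fin n → D))) :=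
  (opPow n X).submatrix (arrowTripleEquiv A B D n) (arrowTripleEquiv A B D n)

theorem trace_tripartitePow_mul (n : ℕ) (X Y : Op (A × (B × D))) :
    (tripartitePow n X * tripartitePow n Y).trace = (X * Y).trace ^ n := by
  rw [tripartitePow, tripartitePow, Matrix.submatrix_mul_equiv, opPow_mul, ← trace_opPow]
  exact (arrowTripleEquiv A B D n).sum_comp fun p => (opPow n (X * Y)) p p

/-- Dual feasibility is multiplicative: the sum over sequences of a product is the product of the
single-copy sums. -/
theorem traceFst_tripartitePow (n : ℕ) {W : Op (A × (B × D))} {ρ : Op B}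
    (h : traceFst W = ρ ⊗ₖ (1 : Op D)) :
    traceFst (tripartitePow n W) = opPow n ρ ⊗ₖ (1 : Op (Fin n → D)) := by
  have h' : ∀ k k', ∑ a, W (a, k) (a, k') = ρ k.1 k'.1 * (1 : Op D) k.2 k'.2 := fun k k' => by
    rw [← traceFst_apply, h, Matrix.kroneckerMap_apply]
  ext k k'
  rw [traceFst_apply, Matrix.kroneckerMap_apply]
  have : (1 : Op (Fin n → D)) k.2 k'.2 = ∏ i, (1 : Op D) (k.2 i) (k'.2 i) := by
    simp only [Matrix.one_apply, Finset.prod_ite_zero, Finset.prod_const_one, funext_iff,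
      Finset.mem_univ, true_imp_iff]
  rw [this, opPow, Matrix.of_apply, ← Finset.prod_mul_distrib]
  simp only [← h' (_, _) (_, _), Finset.prod_univ_sum, Fintype.piFinset_univ]
  rfl

variable {A₀ B₀ A₁ B₁ : Type*}
  [Fintype A₀] [DecidableEq A₀] [Fintype B₀] [DecidableEq B₀]
  [Fintype A₁] [DecidableEq A₁] [Fintype B₁] [DecidableEq B₁]

theorem tensorPow_single (N : OpMap (A₀ × B₀) (A₁ × B₁)) (n : ℕ)
    (p q : (Fin n → A₀) × (Fin n → B₀)) (r s : (Fin n → A₁) × (Fin n → B₁)) :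
    tensorPow N n (Matrix.single p q 1) r s =
      ∏ i, N (Matrix.single (p.1 i, p.2 i) (q.1 i, q.2 i) 1) (r.1 i, r.2 i) (s.1 i, s.2 i) := by
  simp only [tensorPow, LinearMap.coe_mk, AddHom.coe_mk, Matrix.sum_apply, Matrix.smul_apply,
    Matrix.of_apply]
  rw [Fintype.sum_eq_single p, Fintype.sum_eq_single q]
  · simp
  all_goals
    intro x hx
    simp [hx.symm]

theorem bobChoi_tensorPow (N : OpMap (A₀ × B₀) (A₁ × B₁)) (n : ℕ) :
    bobChoi (tensorPow N n) = tripartitePow n (bobChoi N) := by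
  ext p q
  simp only [bobChoi_apply, tensorPow_single, tripartitePow, opPow, Matrix.submatrix_apply,
    Matrix.of_apply, Finset.prod_univ_sum, Fintype.piFinset_univ]
  rfl

end TensorPower

/-! ### Value of a dual witness on simulated channels -/

section WeakDuality

variable {A₀ B₀ A₁ B₁ : Type*}
  [Fintype A₀] [DecidableEq A₀] [Fintype B₀] [DecidableEq B₀]
  [Fintype A₁] [DecidableEq A₁] [Fintype B₁] [DecidableEq B₁]

theorem maxMixed_kronecker_single (b b' : B₀) :
    maxMixed A₀ ⊗ₖ Matrix.single b b' (1 : ℂ) =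
      (Fintype.card A₀ : ℂ)⁻¹ • ∑ a : A₀, Matrix.single (a, b) (a, b') (1 : ℂ) := by
  ext i j
  rw [Matrix.smul_apply, Matrix.sum_apply, Fintype.sum_eq_single i.1]
  · by_cases h : i.1 = j.1 <;>
      simp [Matrix.kroneckerMap_apply, maxMixed_apply, Matrix.single_apply, Prod.ext_iff, h]
  · intro x hx
    simp [Prod.ext_iff, hx]

/-- Randomizing Alice's input averages over its diagonal, leaving 1 ⊗ C with C the Choi matrix of
Bob's resulting map. -/
theorem bobChoi_comp_replaceFst (M : OpMap (A₀ × B₀) (A₁ × B₁)) :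
    bobChoi (M ∘ₗ replaceFst A₀ B₀) =
      (1 : Op A₀) ⊗ₖ ((Fintype.card A₀ : ℂ)⁻¹ • traceFst (bobChoi M)) := by
  ext p q
  simp only [bobChoi_apply, LinearMap.comp_apply, replaceFst_single, Matrix.kronecker_smul,
    map_smul, maxMixed_kronecker_single, map_sum, Matrix.smul_apply, Matrix.sum_apply,
    smul_eq_mul, Matrix.kroneckerMap_apply, Matrix.one_apply, traceFst_apply, ← Finset.mul_sum]
  rw [Finset.sum_comm]

theorem traceSnd_traceFst_bobChoi [Nonempty A₀] {M : OpMap (A₀ × B₀) (A₁ × B₁)}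
    (h : IsChannel M) :
    traceSnd ((Fintype.card A₀ : ℂ)⁻¹ • traceFst (bobChoi M)) = 1 := by
  ext b b'
  have h1 : ∀ a : A₀, ∑ d, ∑ c, M (Matrix.single (a, b) (a, b') 1) (c, d) (c, d) =
      if b = b' then 1 else 0 := fun a => by
    rw [Finset.sum_comm, ← Fintype.sum_prod_type', (isChannel_iff_choi.mp h).2]
    simp
  rw [map_smul, Matrix.smul_apply, traceSnd_apply]
  simp only [traceFst_apply, bobChoi_apply]
  rw [Finset.sum_comm]
  simp only [h1, Matrix.one_apply]
  split_ifs <;> simp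

/-- For a channel that ignores Alice's input, dual feasible operators have value `1`. -/
theorem trace_bobChoi_mul_of_replaceFst [Nonempty A₀] {M : OpMap (A₀ × B₀) (A₁ × B₁)}
    (hM : IsChannel M) (h : bobChoi (M ∘ₗ replaceFst A₀ B₀) = bobChoi M)
    {W : Op (A₀ × (B₀ × B₁))} {ρ : Op B₀} (hρ : ρ.trace = 1)
    (hW : traceFst W = ρ ⊗ₖ (1 : Op B₁)) : (bobChoi M * W).trace = 1 := by
  rw [← h, bobChoi_comp_replaceFst, trace_one_kronecker_mul, hW, Matrix.trace_mul_comm,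
    trace_kronecker_one_mul, traceSnd_traceFst_bobChoi hM, Matrix.mul_one, hρ]

theorem replaceFst_comp_classicalSwap_apply (m : ℕ) (p q r s : Fin m × Fin m) :
    (replaceFst (Fin m) (Fin m) ∘ₗ classicalSwap m) (Matrix.single p q 1) r s =
      if r = s ∧ p = q ∧ p.1 = r.2 then (m : ℂ)⁻¹ else 0 := by
  have : ∀ c, classicalSwap m (Matrix.single p q 1) (c, r.2) (c, s.2) =
      if c = p.2 then (if r.2 = s.2 ∧ p = q ∧ p.1 = r.2 then 1 else 0) else 0 := fun c => by
    change Matrix.diagonal _ _ _ = _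
    simp only [Matrix.diagonal_apply, Matrix.single_apply, Prod.ext_iff]
    grind
  rw [LinearMap.comp_apply, replaceFst_apply]
  simp only [this, Finset.sum_ite_eq', Finset.mem_univ, if_true, maxMixed_apply, Fintype.card_fin]
  simp only [Prod.ext_iff]
  grind

theorem tensorMap_replacer_single (m : ℕ) (p q r s : Fin m × Fin m) :
    tensorMap (replacer (Fin m) (Fin m)) (replacer (Fin m) (Fin m)) (Matrix.single p q 1) r s =
      if r = s ∧ p = q then (m : ℂ)⁻¹ * (m : ℂ)⁻¹ else 0 := by
  simp only [tensorMap_single, Matrix.kroneckerMap_apply, replacer_single, maxMixed_apply,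
    Fintype.card_fin, Prod.ext_iff]
  grind

theorem isChannel_of_diagonal_choi {A B : Type*} [Fintype A] [DecidableEq A] [Fintype B]
    [DecidableEq B] {Φ : OpMap A B} {d : A × B → ℂ} (hΦ : choi Φ = Matrix.diagonal d)
    (hd : ∀ p, 0 ≤ d p) (hsum : ∀ a, ∑ b, d (a, b) = 1) : IsChannel Φ := by
  refine isChannel_iff_choi.mpr ⟨?_, fun a a' => ?_⟩
  · rw [hΦ]
    exact Matrix.PosSemidef.diagonal hd
  · have : ∀ b, Φ (Matrix.single a a' 1) b b = Matrix.diagonal d (a, b) (a', b) := fun b => by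
      rw [← hΦ, choi_apply]
    simp only [this, Matrix.diagonal_apply, Prod.mk.injEq, and_true]
    split_ifs with h
    · exact hsum a
    · simp

theorem isChannel_tensorMap_replacer {m : ℕ} (hm : 1 ≤ m) :
    IsChannel (tensorMap (replacer (Fin m) (Fin m)) (replacer (Fin m) (Fin m))) := by
  have hm0 : (m : ℂ) ≠ 0 := by exact_mod_cast (by omega : m ≠ 0)
  refine isChannel_of_diagonal_choi (d := fun _ => (m : ℂ)⁻¹ * (m : ℂ)⁻¹) ?_
    (fun _ => by positivity) fun a => ?_
  · ext p q
    rw [choi_apply, tensorMap_replacer_single, Matrix.diagonal_apply]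
    simp only [Prod.ext_iff]
    grind
  · simp only [Finset.sum_const, Finset.card_univ, Fintype.card_prod, Fintype.card_fin,
      nsmul_eq_mul, Nat.cast_mul]
    field_simp

/-- The normalized complement of Alice's half of `Υ_m` in `m` times the replacement channel. -/
theorem isChannel_complement {m : ℕ} (hm : 2 ≤ m) :
    IsChannel (((m : ℂ) - 1)⁻¹ •
      ((m : ℂ) • tensorMap (replacer (Fin m) (Fin m)) (replacer (Fin m) (Fin m)) -
        replaceFst (Fin m) (Fin m) ∘ₗ classicalSwap m)) := by
  have hm0 : (m : ℂ) ≠ 0 := by exact_mod_cast (by omega : m ≠ 0)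
  have hm1 : (m : ℂ) - 1 = ((m - 1 : ℕ) : ℂ) := by
    rw [Nat.cast_sub (by omega), Nat.cast_one]
  have hm2 : (m : ℂ) - 1 ≠ 0 := by
    rw [hm1]
    exact_mod_cast (by omega : m - 1 ≠ 0)
  -- The classical channel giving Alice a uniform output and Bob a uniform value different from
  -- Alice's input.
  refine isChannel_of_diagonal_choi (d := fun x =>
    ((m : ℂ) - 1)⁻¹ * ((m : ℂ)⁻¹ * if x.1.1 = x.2.2 then 0 else 1)) ?_ (fun x => ?_) fun a => ?_
  · ext p q
    rw [choi_apply, LinearMap.smul_apply, LinearMap.sub_apply, LinearMap.smul_apply,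
      Matrix.smul_apply, Matrix.sub_apply, Matrix.smul_apply, tensorMap_replacer_single,
      replaceFst_comp_classicalSwap_apply, Matrix.diagonal_apply, smul_eq_mul, smul_eq_mul]
    have : (m : ℂ) * ((m : ℂ)⁻¹ * (m : ℂ)⁻¹) = (m : ℂ)⁻¹ := by field_simp
    simp only [Prod.ext_iff]
    grind
  · rw [hm1]
    split_ifs <;> positivity
  · rw [← Finset.mul_sum, ← Finset.mul_sum, Fintype.sum_prod_type]
    have : ∀ a : Fin m, ∑ b, (if a = b then (0 : ℂ) else 1) = m - 1 := fun a => by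
      have h : ∀ b, (if a = b then (0 : ℂ) else 1) = 1 - if a = b then 1 else 0 := fun b => by
        split_ifs <;> simp
      simp only [h, Finset.sum_sub_distrib]
      simp
    simp only [this]
    rw [Finset.sum_const, Finset.card_univ, Fintype.card_fin, nsmul_eq_mul]
    field_simp

theorem replaceFst_comp_classicalSwap_one :
    replaceFst (Fin 1) (Fin 1) ∘ₗ classicalSwap 1 =
      tensorMap (replacer (Fin 1) (Fin 1)) (replacer (Fin 1) (Fin 1)) := by
  refine opMap_ext fun p q r s => ?_
  rw [replaceFst_comp_classicalSwap_apply, tensorMap_replacer_single]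
  simp [Subsingleton.elim p q, Subsingleton.elim r s, Subsingleton.elim q.1 s.2]

/-- Weak duality: a dual feasible operator has value at most `m` on the simulation of a channel
from `Υ_m`. -/
theorem re_trace_bobChoi_mul_le [Nonempty A₀] [Nonempty A₁] {m : ℕ} (hm : 1 ≤ m)
    {Θ : Supermap (Fin m × Fin m) (Fin m × Fin m) (A₀ × B₀) (A₁ × B₁)}
    (hch : ∀ F, IsChannel F → IsChannel (Θ F))
    (hin : ∀ F, replaceFst A₁ B₁ ∘ₗ Θ (F ∘ₗ replaceFst (Fin m) (Fin m)) ∘ₗ replaceFst A₀ B₀ =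
      replaceFst A₁ B₁ ∘ₗ Θ (F ∘ₗ replaceFst (Fin m) (Fin m)))
    (hout : ∀ F, replaceFst A₁ B₁ ∘ₗ Θ (replaceFst (Fin m) (Fin m) ∘ₗ F) =
      replaceFst A₁ B₁ ∘ₗ Θ F)
    {W : Op (A₀ × (B₀ × B₁))} {ρ : Op B₀} (hW : W.PosSemidef) (hρ : ρ.trace = 1)
    (hWρ : traceFst W = ρ ⊗ₖ (1 : Op B₁)) :
    (bobChoi (Θ (classicalSwap m)) * W).trace.re ≤ m := by
  have hmn : Nonempty (Fin m) := ⟨⟨0, hm⟩⟩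
  set Q := tensorMap (replacer (Fin m) (Fin m)) (replacer (Fin m) (Fin m)) with hQ
  -- Q absorbs a replacement on Alice's input, which brings it into the form required by `hin`.
  have hQR : Q ∘ₗ replaceFst (Fin m) (Fin m) = Q := by
    refine opMap_ext fun p q r s => ?_
    rw [LinearMap.comp_apply, replaceFst_single]
    rw [Matrix.kronecker_smul, map_smul, maxMixed_kronecker_single, map_smul, map_sum,
      Matrix.smul_apply, Matrix.smul_apply, Matrix.sum_apply]
    simp only [hQ, tensorMap_replacer_single, Prod.ext_iff, true_and]
    have hm0 : (m : ℂ) ≠ 0 := by exact_mod_cast (by omega : m ≠ 0)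
    simp only [Finset.sum_const, Finset.card_univ, Fintype.card_fin, nsmul_eq_mul, smul_eq_mul]
    rw [← mul_assoc (_⁻¹) (m : ℂ), inv_mul_cancel₀ hm0]
    grind
  have hQ1 : (bobChoi (Θ Q) * W).trace = 1 := by
    refine trace_bobChoi_mul_of_replaceFst (hch Q (isChannel_tensorMap_replacer hm)) ?_ hρ hWρ
    have := hin Q
    rw [hQR] at this
    rw [← bobChoi_replaceFst_comp, this, bobChoi_replaceFst_comp]
  rw [← bobChoi_replaceFst_comp, ← hout, bobChoi_replaceFst_comp]
  -- For m = 1 the factor (m-1)⁻¹ is unavailable, but then S and Q coincide.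
  rcases Nat.lt_or_ge m 2 with h2 | h2
  · obtain rfl : m = 1 := by omega
    rw [replaceFst_comp_classicalSwap_one, ← hQ, hQ1]
    simp
  · set S := replaceFst (Fin m) (Fin m) ∘ₗ classicalSwap m
    have hm2 : (m : ℂ) - 1 ≠ 0 := by
      rw [← Nat.cast_one, ← Nat.cast_sub (by omega)]
      exact_mod_cast (by omega : m - 1 ≠ 0)
    set F := ((m : ℂ) - 1)⁻¹ • ((m : ℂ) • Q - S) with hF
    have hFch : IsChannel F := isChannel_complement h2
    have hS : S = (m : ℂ) • Q - ((m : ℂ) - 1) • F := by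
      rw [hF, smul_smul, mul_inv_cancel₀ hm2, one_smul, sub_sub_cancel]
    have hpos : 0 ≤ ((m : ℂ) - 1) * (bobChoi (Θ F) * W).trace := by
      refine mul_nonneg ?_
        (trace_mul_nonneg (posSemidef_bobChoi (isChannel_iff_choi.mp (hch F hFch)).1) hW)
      rw [← Nat.cast_one, ← Nat.cast_sub (by omega)]
      positivity
    rw [hS, map_sub, map_smul, map_smul, map_sub, map_smul, map_smul, Matrix.sub_mul,
      Matrix.smul_mul, Matrix.smul_mul, Matrix.trace_sub, Matrix.trace_smul, Matrix.trace_smul,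
      hQ1, smul_eq_mul, smul_eq_mul, mul_one, Complex.sub_re, Complex.natCast_re]
    linarith [(Complex.le_def.mp hpos).1, Complex.zero_re]

end WeakDuality

/-! ### Channels from Choi matrices; superchannels with trivial reference -/

section Superchannel

variable {A B C D : Type*} [Fintype A] [DecidableEq A] [Fintype B] [DecidableEq B]
  [Fintype C] [DecidableEq C] [Fintype D] [DecidableEq D]

/-- The linear map with a given Choi matrix. -/
def ofChoi (X : Op (A × B)) : OpMap A B where
  toFun Y := Matrix.of fun b b' => ∑ a, ∑ a', Y a a' * X (a, b) (a', b')
  map_add' Y Z := by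
    ext b b'
    simp [add_mul, Finset.sum_add_distrib]
  map_smul' z Y := by
    ext b b'
    simp [Finset.mul_sum, mul_assoc]

theorem ofChoi_single (X : Op (A × B)) (a a' : A) (b b' : B) :
    ofChoi X (Matrix.single a a' 1) b b' = X (a, b) (a', b') := by
  change ∑ c, ∑ c', Matrix.single a a' (1 : ℂ) c c' * X (c, b) (c', b') = _
  rw [Fintype.sum_eq_single a, Fintype.sum_eq_single a']
  · simp
  all_goals
    intro x hx
    simp [hx.symm]

theorem choi_ofChoi (X : Op (A × B)) : choi (ofChoi X) = X := by
  ext p q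
  rw [choi_apply, ofChoi_single]

theorem isChannel_ofChoi {X : Op (A × B)} (hX : X.PosSemidef) (h : traceSnd X = 1) :
    IsChannel (ofChoi X) := by
  refine isChannel_iff_choi.mpr ⟨by rwa [choi_ofChoi], fun a a' => ?_⟩
  simp only [ofChoi_single]
  rw [← traceSnd_apply, h, Matrix.one_apply]

/-- Take one-dimensional reference systems: then every reference component of id ⊗ F is F itself. -/
theorem IsSuperchannel.map_isChannel {Θ : Supermap A B C D} (hΘ : IsSuperchannel Θ)
    {F : OpMap A B} (hF : IsChannel F) : IsChannel (Θ F) := by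
  set N : OpMap (Fin 1 × A) (Fin 1 × B) := tensorMap LinearMap.id F with hN
  have hNs : ∀ p q r s, N (Matrix.single p q 1) r s = F (Matrix.single p.2 q.2 1) r.2 s.2 :=
    fun p q r s => by
      rw [hN, tensorMap_single, LinearMap.id_apply, Matrix.kroneckerMap_apply, Matrix.single_apply,
        if_pos ⟨Subsingleton.elim _ _, Subsingleton.elim _ _⟩, one_mul]
  obtain ⟨hF1, hF2⟩ := isChannel_iff_choi.mp hF
  have hNc : IsChannel N := by
    refine isChannel_iff_choi.mpr ⟨?_, fun p q => ?_⟩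
    · refine posSemidef_of_eq (hF1.submatrix
        (fun x : (Fin 1 × A) × (Fin 1 × B) => (x.1.2, x.2.2))) ?_
      ext p q
      rw [choi_apply, hNs]
      rfl
    · simp only [hNs, Fintype.sum_prod_type, Finset.univ_unique, Finset.sum_singleton, hF2,
        Prod.ext_iff, Subsingleton.elim p.1 q.1, true_and]
  have hcomp : ∀ r₀ r₀' r₁ r₁' : Fin 1, refComponent N r₀ r₀' r₁ r₁' = F := fun r₀ r₀' r₁ r₁' => by
    refine opMap_ext fun a a' b b' => ?_
    change N (Matrix.single r₀ r₀' 1 ⊗ₖ Matrix.single a a' 1) (r₁, b) (r₁', b') = _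
    rw [Matrix.single_kronecker_single, mul_one, hNs]
  have hΘN : ∀ a a' d d', Θ.withRef N (Matrix.single (0, a) (0, a') 1) (0, d) (0, d') =
      Θ F (Matrix.single a a' 1) d d' := fun a a' d d' => by
    change ∑ r₀, ∑ r₀', Θ (refComponent N r₀ r₀' 0 0) _ d d' = _
    have hs : ∀ o o' : Fin 1, (Matrix.single ((0 : Fin 1), a) (0, a') (1 : ℂ)).submatrix
        (Prod.mk o) (Prod.mk o') = Matrix.single a a' 1 := fun o o' => by
      rw [Subsingleton.elim o 0, Subsingleton.elim o' 0]
      ext x y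
      simp [Matrix.single_apply]
    simp only [hcomp, hs, Finset.univ_unique, Finset.sum_singleton]
  obtain ⟨h1, h2⟩ := isChannel_iff_choi.mp (hΘ 1 1 N hNc)
  refine isChannel_iff_choi.mpr ⟨?_, fun a a' => ?_⟩
  · refine posSemidef_of_eq (h1.submatrix (fun x : C × D => ((0, x.1), (0, x.2)))) ?_
    ext p q
    exact (hΘN _ _ _ _).symm
  · have := h2 (0, a) (0, a')
    simpa [Fintype.sum_prod_type, hΘN] using this

end Superchannel

/-! ### Entrywise control by the diamond norm -/

section DiamondNorm

variable {A B : Type*} [Fintype A] [DecidableEq A] [Fintype B] [DecidableEq B]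

theorem sum_eigenvalues_conjTranspose_mul_self (X : Op A) :
    ∑ i, (Matrix.isHermitian_conjTranspose_mul_self X).eigenvalues i = ∑ i, ∑ j, ‖X i j‖ ^ 2 := by
  have h := (Matrix.isHermitian_conjTranspose_mul_self X).trace_eq_sum_eigenvalues
  have h2 : (X.conjTranspose * X).trace = ((∑ i, ∑ j, ‖X i j‖ ^ 2 : ℝ) : ℂ) := by
    rw [Finset.sum_comm]
    simp [Matrix.trace, Matrix.mul_apply, Complex.conj_mul']
  apply Complex.ofReal_injective
  rw [← h2, h]
  push_cast
  rfl

/-- An entry is at most the Hilbert–Schmidt norm, the ℓ² norm of the singular values, which is at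
most their ℓ¹ norm. -/
theorem norm_apply_le_traceNorm (X : Op A) (i j : A) : ‖X i j‖ ≤ traceNorm X := by
  have hn := Matrix.eigenvalues_conjTranspose_mul_self_nonneg X
  have h0 : 0 ≤ traceNorm X := Finset.sum_nonneg fun _ _ => Real.sqrt_nonneg _
  refine le_of_sq_le_sq ?_ h0
  calc ‖X i j‖ ^ 2 ≤ ∑ i, ∑ j, ‖X i j‖ ^ 2 := by
        refine (Finset.single_le_sum (f := fun j => ‖X i j‖ ^ 2) (fun _ _ => by positivity)
          (Finset.mem_univ j)).trans ?_
        exact Finset.single_le_sum (f := fun i => ∑ j, ‖X i j‖ ^ 2) (fun _ _ => by positivity)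
          (Finset.mem_univ i)
    _ = ∑ i, √((Matrix.isHermitian_conjTranspose_mul_self X).eigenvalues i) ^ 2 := by
        rw [← sum_eigenvalues_conjTranspose_mul_self]
        exact Finset.sum_congr rfl fun i _ => (Real.sq_sqrt (hn i)).symm
    _ ≤ traceNorm X ^ 2 := Finset.sum_sq_le_sq_sum_of_nonneg fun _ _ => Real.sqrt_nonneg _

/-- Each of the `card A` singular values is at most the Hilbert–Schmidt norm, here 1 / `card A`. The
scaling is lossy, but enough where only vanishing error matters. -/
theorem traceNorm_single_le (p q : A) :
    traceNorm (Matrix.single p q ((Fintype.card A : ℂ)⁻¹)) ≤ 1 := by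
  set X : Op A := Matrix.single p q ((Fintype.card A : ℂ)⁻¹) with hX
  have hn := Matrix.eigenvalues_conjTranspose_mul_self_nonneg X
  have hcard : (0 : ℝ) < Fintype.card A := by
    exact_mod_cast Fintype.card_pos_iff.mpr ⟨p⟩
  have hs : ∑ i, ∑ j, ‖X i j‖ ^ 2 = ((Fintype.card A : ℝ)⁻¹) ^ 2 := by
    rw [Fintype.sum_eq_single p, Fintype.sum_eq_single q]
    · simp [hX]
    all_goals
      intro x hx
      simp [hX, hx.symm]
  have hi : ∀ i, √((Matrix.isHermitian_conjTranspose_mul_self X).eigenvalues i) ≤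
      (Fintype.card A : ℝ)⁻¹ := fun i => by
    refine Real.sqrt_le_iff.mpr ⟨by positivity, ?_⟩
    rw [← hs, ← sum_eigenvalues_conjTranspose_mul_self]
    exact Finset.single_le_sum (fun k _ => hn k) (Finset.mem_univ i)
  refine (Finset.sum_le_sum fun i _ => hi i).trans ?_
  rw [Finset.sum_const, Finset.card_univ, nsmul_eq_mul, mul_inv_cancel₀ hcard.ne']

theorem ofReal_norm_apply_le_diamondNorm (F : OpMap A B) (p q : A) (i j : B) :
    ENNReal.ofReal ((Fintype.card A : ℝ)⁻¹ * ‖F (Matrix.single p q 1) i j‖) ≤ diamondNorm F := by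
  set z : ℂ := (Fintype.card (A × Fin 1) : ℂ)⁻¹ with hz
  have h1 : ∀ (p q : A × Fin 1) (i j : B × Fin 1),
      tensorMap F (LinearMap.id : OpMap (Fin 1) (Fin 1)) (Matrix.single p q z) i j =
        z * F (Matrix.single p.1 q.1 1) i.1 j.1 := fun p q i j => by
    have : Matrix.single p q z = z • Matrix.single p q 1 := by simp
    rw [this, map_smul, Matrix.smul_apply, tensorMap_single, LinearMap.id_apply,
      Matrix.kroneckerMap_apply, Matrix.single_apply,
      if_pos ⟨Subsingleton.elim _ _, Subsingleton.elim _ _⟩, mul_one, smul_eq_mul]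
  refine le_trans (ENNReal.ofReal_le_ofReal ?_) (le_iSup₂_of_le 1
    (Matrix.single (p, (0 : Fin 1)) (q, 0) z) (le_iSup_of_le (traceNorm_single_le _ _) le_rfl))
  refine le_trans (le_of_eq ?_) (norm_apply_le_traceNorm _ (i, 0) (j, 0))
  rw [h1, norm_mul, hz]
  simp

end DiamondNorm

/-! ### From approximate simulation to the bound t^n ≤ m -/

section Simulation

variable {A₀ B₀ A₁ B₁ : Type*}
  [Fintype A₀] [DecidableEq A₀] [Fintype B₀] [DecidableEq B₀]
  [Fintype A₁] [DecidableEq A₁] [Fintype B₁] [DecidableEq B₁]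

/-- The map `M` can be approximated entrywise from `Υ_m` by supermaps that preserve channels and
are non-signalling from Alice to Bob. -/
def IsSimulable (m : ℕ) (M : OpMap (A₀ × B₀) (A₁ × B₁)) : Prop :=
  ∀ ε : ℝ, 0 < ε → ∃ Θ : Supermap (Fin m × Fin m) (Fin m × Fin m) (A₀ × B₀) (A₁ × B₁),
    (∀ F, IsChannel F → IsChannel (Θ F)) ∧
    (∀ F, replaceFst A₁ B₁ ∘ₗ Θ (F ∘ₗ replaceFst (Fin m) (Fin m)) ∘ₗ replaceFst A₀ B₀ =
      replaceFst A₁ B₁ ∘ₗ Θ (F ∘ₗ replaceFst (Fin m) (Fin m))) ∧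
    (∀ F, replaceFst A₁ B₁ ∘ₗ Θ (replaceFst (Fin m) (Fin m) ∘ₗ F) =
      replaceFst A₁ B₁ ∘ₗ Θ F) ∧
    ∀ p q i j, ‖(Θ (classicalSwap m) - M) (Matrix.single p q 1) i j‖ ≤ ε

theorem norm_trace_bobChoi_mul_le {Δ : OpMap (A₀ × B₀) (A₁ × B₁)} {ε : ℝ}
    (h : ∀ p q i j, ‖Δ (Matrix.single p q 1) i j‖ ≤ ε) (W : Op (A₀ × (B₀ × B₁))) :
    ‖(bobChoi Δ * W).trace‖ ≤ ε * (Fintype.card A₁ * ∑ x, ∑ y, ‖W y x‖) := by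
  rw [Finset.mul_sum, Finset.mul_sum]
  refine (norm_sum_le _ _).trans (Finset.sum_le_sum fun x _ => ?_)
  rw [Matrix.diag_apply, Matrix.mul_apply, Finset.mul_sum, Finset.mul_sum]
  refine (norm_sum_le _ _).trans (Finset.sum_le_sum fun y _ => ?_)
  rw [norm_mul, bobChoi_apply, ← mul_assoc]
  refine mul_le_mul_of_nonneg_right ((norm_sum_le _ _).trans ?_) (norm_nonneg _)
  refine (Finset.sum_le_sum fun c _ => h _ _ _ _).trans_eq ?_
  rw [Finset.sum_const, Finset.card_univ, nsmul_eq_mul, mul_comm]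

theorem re_trace_bobChoi_mul_le_of_isSimulable [Nonempty A₀] [Nonempty A₁] {m : ℕ} (hm : 1 ≤ m)
    {M : OpMap (A₀ × B₀) (A₁ × B₁)} (hM : IsSimulable m M)
    {W : Op (A₀ × (B₀ × B₁))} {ρ : Op B₀} (hW : W.PosSemidef) (hρ : ρ.trace = 1)
    (hWρ : traceFst W = ρ ⊗ₖ (1 : Op B₁)) : (bobChoi M * W).trace.re ≤ m := by
  set K : ℝ := Fintype.card A₁ * ∑ x, ∑ y, ‖W y x‖ with hK
  have hK0 : 0 ≤ K := by positivity
  refine le_of_forall_pos_le_add fun ε hε => ?_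
  -- Entrywise error δ changes the value by at most K δ; the denominator K + 1 avoids division by
  -- zero.
  obtain ⟨Θ, hch, hin, hout, hΘ⟩ := hM (ε / (K + 1)) (by positivity)
  have h1 := re_trace_bobChoi_mul_le hm hch hin hout hW hρ hWρ
  have h2 := norm_trace_bobChoi_mul_le hΘ W
  have h3 : (bobChoi M * W).trace = (bobChoi (Θ (classicalSwap m)) * W).trace -
      (bobChoi (Θ (classicalSwap m) - M) * W).trace := by
    rw [map_sub, Matrix.sub_mul, Matrix.trace_sub, sub_sub_cancel]
  have h4 : ε / (K + 1) * K ≤ ε := by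
    rw [div_mul_eq_mul_div, div_le_iff₀ (by positivity)]
    nlinarith
  rw [h3, Complex.sub_re]
  have h5 := Complex.abs_re_le_norm (bobChoi (Θ (classicalSwap m) - M) * W).trace
  linarith [neg_abs_le (bobChoi (Θ (classicalSwap m) - M) * W).trace.re]

/-- If the single-copy program is infeasible at `t`, then a simulation of `n` copies needs a
classical channel of dimension at least `t ^ n`. -/
theorem pow_le_of_isSimulable_tensorPow [Nonempty A₀] [Nonempty A₁] [Nonempty B₁]
    {N : OpMap (A₀ × B₀) (A₁ × B₁)} (hN : IsChannel N) {t : ℝ} (ht : 0 < t)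
    (h : ∀ X : OpMap B₀ B₁, IsChannel X →
      ¬ (choi ((t : ℂ) • tensorMap (replacer A₀ A₁) X - replaceFst A₁ B₁ ∘ₗ N)).PosSemidef)
    {n m : ℕ} (hm : 1 ≤ m) (hs : IsSimulable m (tensorPow N n)) : t ^ n ≤ m := by
  have hJ := posSemidef_bobChoi (isChannel_iff_choi.mp hN).1
  obtain ⟨W, ρ, hW, hρ, hWρ, hval⟩ := exists_dual_of_infeasible ht hJ fun C hC hC1 hCt => by
    refine h (ofChoi C) (isChannel_ofChoi hC hC1) (choi_replace_sub_posSemidef ?_)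
    rw [choi_ofChoi]
    exact hCt
  have hp := trace_mul_nonneg hJ hW
  -- The value is real, so the real part of its n-th power is the n-th power of its real part.
  have hv : (bobChoi N * W).trace = ((bobChoi N * W).trace.re : ℂ) :=
    Complex.ext rfl (by simpa using (Complex.le_def.mp hp).2.symm)
  have key := re_trace_bobChoi_mul_le_of_isSimulable hm hs
    ((posSemidef_opPow n hW).submatrix (arrowTripleEquiv A₀ B₀ B₁ n))
    (by rw [trace_opPow, hρ, one_pow]) (traceFst_tripartitePow n hWρ)
  rw [bobChoi_tensorPow, ← tripartitePow, trace_tripartitePow_mul, hv, ← Complex.ofReal_pow,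
    Complex.ofReal_re] at key
  exact (pow_le_pow_left₀ ht.le hval n).trans key

end Simulation

/-! ### Exchanging Alice and Bob -/

section Swap

variable {A₀ B₀ A₁ B₁ A₂ B₂ : Type*}
  [Fintype A₀] [DecidableEq A₀] [Fintype B₀] [DecidableEq B₀]
  [Fintype A₁] [DecidableEq A₁] [Fintype B₁] [DecidableEq B₁]
  [Fintype A₂] [DecidableEq A₂] [Fintype B₂] [DecidableEq B₂]

/-- Exchange of the two parties of a bipartite map. -/
def swapMap : OpMap (A₀ × B₀) (A₁ × B₁) →ₗ[ℂ] OpMap (B₀ × A₀) (B₁ × A₁) where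
  toFun M :=
    { toFun := fun X => (M (X.submatrix Prod.swap Prod.swap)).submatrix Prod.swap Prod.swap
      map_add' := fun X Y => by
        rw [Matrix.submatrix_add, Pi.add_apply, Pi.add_apply, map_add]
        rfl
      map_smul' := fun z X => by
        rw [Matrix.submatrix_smul, Pi.smul_apply, Pi.smul_apply, map_smul]
        rfl }
  map_add' M M' := rfl
  map_smul' z M := rfl

theorem swapMap_apply (M : OpMap (A₀ × B₀) (A₁ × B₁)) (X : Op (B₀ × A₀)) :
    swapMap M X = (M (X.submatrix Prod.swap Prod.swap)).submatrix Prod.swap Prod.swap := rfl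

theorem swapMap_single (M : OpMap (A₀ × B₀) (A₁ × B₁)) (p q : B₀ × A₀) (r s : B₁ × A₁) :
    swapMap M (Matrix.single p q 1) r s = M (Matrix.single p.swap q.swap 1) r.swap s.swap := by
  have : (Matrix.single p q (1 : ℂ)).submatrix Prod.swap Prod.swap =
      Matrix.single p.swap q.swap 1 := by
    ext x y
    simp only [Matrix.submatrix_apply, Matrix.single_apply, Prod.ext_iff, Prod.fst_swap,
      Prod.snd_swap]
    grind
  rw [swapMap_apply, this]
  rfl

theorem swapMap_swapMap (M : OpMap (A₀ × B₀) (A₁ × B₁)) : swapMap (swapMap M) = M := rfl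

theorem swapMap_comp (M : OpMap (A₁ × B₁) (A₂ × B₂)) (N : OpMap (A₀ × B₀) (A₁ × B₁)) :
    swapMap (M ∘ₗ N) = swapMap M ∘ₗ swapMap N := rfl

theorem swapMap_tensorMap (Φ : OpMap A₀ A₁) (Ψ : OpMap B₀ B₁) :
    swapMap (tensorMap Φ Ψ) = tensorMap Ψ Φ := by
  refine opMap_ext fun p q r s => ?_
  rw [swapMap_single, tensorMap_single, tensorMap_single]
  exact mul_comm _ _

theorem swapMap_replaceSnd : swapMap (replaceSnd A₀ B₀) = replaceFst B₀ A₀ :=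
  swapMap_tensorMap _ _

theorem swapMap_replaceFst : swapMap (replaceFst A₀ B₀) = replaceSnd B₀ A₀ :=
  swapMap_tensorMap _ _

theorem swapMap_classicalSwap (m : ℕ) : swapMap (classicalSwap m) = classicalSwap m := by
  refine LinearMap.ext fun X => Matrix.ext fun r s => ?_
  change Matrix.diagonal _ _ _ = Matrix.diagonal _ _ _
  simp only [Matrix.diagonal_apply, Prod.swap_inj]
  rfl

theorem swapMap_tensorPow (N : OpMap (A₀ × B₀) (A₁ × B₁)) (n : ℕ) :
    swapMap (tensorPow N n) = tensorPow (swapMap N) n := by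
  refine opMap_ext fun p q r s => ?_
  rw [swapMap_single, tensorPow_single, tensorPow_single]
  exact Finset.prod_congr rfl fun i _ => 
    (swapMap_single N (p.1 i, p.2 i) (q.1 i, q.2 i) (r.1 i, r.2 i) (s.1 i, s.2 i)).symm

theorem choi_swapMap_posSemidef {M : OpMap (A₀ × B₀) (A₁ × B₁)} (h : (choi M).PosSemidef) :
    (choi (swapMap M)).PosSemidef := by
  refine posSemidef_of_eq (h.submatrix
    (fun x : (B₀ × A₀) × (B₁ × A₁) => (x.1.swap, x.2.swap))) ?_
  ext p q
  rw [choi_apply, swapMap_single]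
  rfl

theorem isChannel_swapMap {M : OpMap (A₀ × B₀) (A₁ × B₁)} (h : IsChannel M) :
    IsChannel (swapMap M) := by
  obtain ⟨h1, h2⟩ := isChannel_iff_choi.mp h
  refine isChannel_iff_choi.mpr ⟨choi_swapMap_posSemidef h1, fun p q => ?_⟩
  simp only [swapMap_single]
  have := (Equiv.prodComm B₁ A₁).sum_comp fun b => M (Matrix.single p.swap q.swap 1) b b
  rw [h2] at this
  exact this.trans (by simp only [Prod.swap_inj])

end Swap

/-! ### Bounding the channel max-relative entropy by a Choi inequality -/

section Entropy

theorem log2_mono : Monotone log2 := fun _ _ h =>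
  EReal.div_le_div_right_of_nonneg (by exact_mod_cast Real.log_nonneg one_le_two)
    (ENNReal.log_monotone h)

theorem channelDmax_le {A B : Type*} [Fintype A] [DecidableEq A] [Fintype B] [DecidableEq B]
    {N E : OpMap A B} {t : ℝ} (ht : 0 < t) (h : (choi ((t : ℂ) • E - N)).PosSemidef) :
    channelDmax N E ≤ log2 (ENNReal.ofReal t) := by
  refine iSup₂_le fun ψ _ => ?_
  have hψ := posSemidef_tensorMap_id (R := A) h (Matrix.posSemidef_vecMulVec_self_star ψ)
  refine log2_mono (iInf₂_le_of_le t.toNNReal ?_ le_rfl)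
  rw [Real.coe_toNNReal t ht.le]
  refine posSemidef_of_eq hψ ?_
  ext p q
  simp only [Matrix.sub_apply, Matrix.smul_apply, tensorMap_id_apply, LinearMap.sub_apply,
    LinearMap.smul_apply, smul_eq_mul, mul_sub, Finset.sum_sub_distrib, Finset.mul_sum]
  congr 1
  refine Finset.sum_congr rfl fun a _ => Finset.sum_congr rfl fun a' _ => ?_
  ring

theorem log2_ofReal {t : ℝ} (ht : 0 < t) :
    log2 (ENNReal.ofReal t) = ((Real.log t / Real.log 2 : ℝ) : EReal) := by
  rw [log2, ENNReal.log_ofReal_of_pos ht, ← EReal.coe_div]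

end Entropy

/-! ### From vanishing simulation error to the asymptotic cost -/

section Cost

variable {A₀ B₀ A₁ B₁ : Type*}
  [Fintype A₀] [DecidableEq A₀] [Fintype B₀] [DecidableEq B₀]
  [Fintype A₁] [DecidableEq A₁] [Fintype B₁] [DecidableEq B₁]

theorem exists_approx_of_simError_le_zero {A₀' B₀' A₁' B₁' : Type*}
    [Fintype A₀'] [DecidableEq A₀'] [Fintype B₀'] [DecidableEq B₀']
    [Fintype A₁'] [DecidableEq A₁'] [Fintype B₁'] [DecidableEq B₁'] [Nonempty (A₀ × B₀)]
    {N : OpMap (A₀' × B₀') (A₁' × B₁')} {M : OpMap (A₀ × B₀) (A₁ × B₁)}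
    (h : simError N M ≤ 0) {ε : ℝ} (hε : 0 < ε) :
    ∃ Θ : Supermap (A₀' × B₀') (A₁' × B₁') (A₀ × B₀) (A₁ × B₁), IsNSSuperchannel Θ ∧
      ∀ p q i j, ‖(Θ N - M) (Matrix.single p q 1) i j‖ ≤ ε := by
  have hc : (0 : ℝ) < Fintype.card (A₀ × B₀) := by exact_mod_cast Fintype.card_pos
  have h0 : (⨅ (Θ : Supermap (A₀' × B₀') (A₁' × B₁') (A₀ × B₀) (A₁ × B₁))
      (_ : IsNSSuperchannel Θ), diamondNorm (Θ N - M)) = 0 := by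
    have := le_antisymm h zero_le
    rw [simError, mul_eq_zero] at this
    exact this.resolve_left (by simp)
  have hlt : (⨅ (Θ : Supermap (A₀' × B₀') (A₁' × B₁') (A₀ × B₀) (A₁ × B₁))
      (_ : IsNSSuperchannel Θ), diamondNorm (Θ N - M)) <
        ENNReal.ofReal ((Fintype.card (A₀ × B₀) : ℝ)⁻¹ * ε) := by
    rw [h0, ENNReal.ofReal_pos]
    positivity
  obtain ⟨Θ, hΘ, hd⟩ := by simpa only [iInf_lt_iff] using hlt
  refine ⟨Θ, hΘ, fun p q i j => ?_⟩
  have h1 := (ofReal_norm_apply_le_diamondNorm (Θ N - M) p q i j).trans hd.le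
  rw [ENNReal.ofReal_le_ofReal_iff (by positivity)] at h1
  exact le_of_mul_le_mul_left h1 (by positivity)

theorem isSimulable_of_simError_le_zero [Nonempty (A₀ × B₀)] {m : ℕ}
    {M : OpMap (A₀ × B₀) (A₁ × B₁)} (h : simError (classicalSwap m) M ≤ 0) :
    IsSimulable m M := fun ε hε => by
  obtain ⟨Θ, hΘ, hd⟩ := exists_approx_of_simError_le_zero h hε
  exact ⟨Θ, fun F => hΘ.isSuperchannel.map_isChannel, hΘ.alice_in, hΘ.alice_out, hd⟩

/-- Conjugating Θ by the exchange of parties turns Bob's non-signalling identities into Alice's, and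
Υ_m is invariant under the exchange. -/
theorem isSimulable_swapMap_of_simError_le_zero [Nonempty (A₀ × B₀)] {m : ℕ}
    {M : OpMap (A₀ × B₀) (A₁ × B₁)} (h : simError (classicalSwap m) M ≤ 0) :
    IsSimulable m (swapMap M) := fun ε hε => by
  obtain ⟨Θ, hΘ, hd⟩ := exists_approx_of_simError_le_zero h hε
  refine ⟨swapMap ∘ₗ Θ ∘ₗ swapMap,
    fun F hF => isChannel_swapMap (hΘ.isSuperchannel.map_isChannel (isChannel_swapMap hF)),
    fun F => ?_, fun F => ?_, fun p q i j => ?_⟩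
  · have := congrArg swapMap (hΘ.bob_in (swapMap F))
    rw [swapMap_comp, swapMap_comp, swapMap_comp, swapMap_replaceSnd, swapMap_replaceSnd,
      ← swapMap_replaceFst, ← swapMap_comp] at this
    exact this
  · have := congrArg swapMap (hΘ.bob_out (swapMap F))
    rw [swapMap_comp, swapMap_comp, swapMap_replaceSnd, ← swapMap_replaceFst,
      ← swapMap_comp] at this
    exact this
  · rw [LinearMap.comp_apply, LinearMap.comp_apply, swapMap_classicalSwap, ← map_sub,
      swapMap_single]
    exact hd _ _ _ _

theorem le_asymptoticExactCost {N : OpMap (A₀ × B₀) (A₁ × B₁)} {L : EReal}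
    (h : ∀ t : ℝ, 0 < t → log2 (ENNReal.ofReal t) < L → ∀ n m : ℕ, 1 ≤ m →
      simError (classicalSwap m) (tensorPow N n) ≤ 0 → t ^ n ≤ m) :
    L ≤ asymptoticExactCost N := by
  have hlog : Real.log 2 ≠ 0 := (Real.log_pos one_lt_two).ne'
  -- The bound is needed only for n ≥ 1, where division by n can be undone. There it suffices to
  -- treat real c < L, with t = 2^c.
  refine le_liminf_of_le (by isBoundedDefault) (eventually_atTop.mpr ⟨1, fun n hn => ?_⟩)
  refine EReal.ge_of_forall_gt_iff_ge.mp fun c hc => ?_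
  have ht : (0 : ℝ) < 2 ^ c := by positivity
  have hn0 : (0 : EReal) < n := by exact_mod_cast hn
  have hpow : log2 (ENNReal.ofReal (((2 : ℝ) ^ c) ^ n)) = (c : EReal) * n := by
    rw [log2_ofReal (by positivity), Real.log_pow, Real.log_rpow two_pos, mul_div_assoc,
      mul_div_cancel_right₀ c hlog, mul_comm, EReal.coe_mul]
    rfl
  have hc' : log2 (ENNReal.ofReal ((2 : ℝ) ^ c)) < L := by
    rwa [log2_ofReal ht, Real.log_rpow two_pos, mul_div_cancel_right₀ c hlog]
  rw [EReal.le_div_iff_mul_le hn0 (EReal.natCast_ne_top n), ← hpow, oneShotCost]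
  refine log2_mono (le_iInf₂ fun m hm => le_iInf fun hs => ?_)
  rw [← ENNReal.ofReal_natCast]
  exact ENNReal.ofReal_le_ofReal (h _ ht hc' n m hm hs)

end Cost

end BiComm

theorem mainTheorem5 {A₀ B₀ A₁ B₁ : Type*}
    [Fintype A₀] [DecidableEq A₀] [Nonempty A₀] [Fintype B₀] [DecidableEq B₀] [Nonempty B₀]
    [Fintype A₁] [DecidableEq A₁] [Nonempty A₁] [Fintype B₁] [DecidableEq B₁] [Nonempty B₁]
    (N : BiComm.OpMap (A₀ × B₀) (A₁ × B₁)) (hN : BiComm.IsChannel N) :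
    -min (BiComm.condMinEntropyAB N) (BiComm.condMinEntropyBA N) ≤
      BiComm.asymptoticExactCost N := by
  open BiComm in
  rw [EReal.neg_le, le_min_iff, condMinEntropyAB, condMinEntropyBA, EReal.neg_le_neg_iff,
    EReal.neg_le_neg_iff]
  constructor
  · refine le_asymptoticExactCost fun t ht hlt n m hm hs => ?_
    refine pow_le_of_isSimulable_tensorPow hN ht (fun X hX hpos => ?_) hm
      (isSimulable_of_simError_le_zero hs)
    -- A feasible X would give a channel max-relative entropy of at most log t, against the choice
    -- of t.
    exact hlt.not_ge (iInf₂_le_of_le X hX (channelDmax_le ht hpos))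
  · refine le_asymptoticExactCost fun t ht hlt n m hm hs => ?_
    refine pow_le_of_isSimulable_tensorPow (n := n) (isChannel_swapMap hN) ht
      (fun Y hY hpos => ?_) hm
      (swapMap_tensorPow N n ▸ isSimulable_swapMap_of_simError_le_zero hs)
    refine hlt.not_ge (iInf₂_le_of_le Y hY (channelDmax_le ht ?_))
    have := choi_swapMap_posSemidef hpos
    rwa [map_sub, map_smul, swapMap_tensorMap, swapMap_comp, swapMap_replaceFst,
      swapMap_swapMap] at this
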